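/- Let $k$ be a field, let $q\in k$ be nonzero, and let $m,n$ be positive integers with $m\le n$. Let $\mathcal{O}_q(M_{mn})$ be the $k$-algebra generated by elements $X_{ij}$ ($1\le i\le m$, $1\le j\le n$) subject to the relations \[ \begin{array}{ll} X_{ij}X_{il}=q\,X_{il}X_{ij} & (1\le i\le m,\ 1\le j<l\le n),\\ X_{ij}X_{rj}=q\,X_{rj}X_{ij} & (1\le i<r\le m,\ 1\le j\le n),\\ X_{il}X_{rj}=X_{rj}X_{il} & (1\le i<r\le m,\ 1\le j<l\le n),\\ X_{ij}X_{rl}-X_{rl}X_{ij}=(q-q^{-1})X_{il}X_{rj} & (1\le i<r\le m,\ 1\le j<l\le n). \end{array} \] For $J=\{j_1<\dots<j_m\}\subseteq\{1,\dots,n\}$, let \[ [J]=\sum_{\sigma\in S_m}(-q)^{\ell(\sigma)}X_{1,j_{\sigma(1)}}\cdots X_{m,j_{\sigma(m)}} \] be the corresponding maximal quantum minor, where $\ell(\sigma)$ is the number of inversions of $\sigma$, and let the quantum grassmannian $\mathcal{G}_q(m,n)$ be the $k$-subalgebra of $\mathcal{O}_q(M_{mn})$ generated by all the $[J]$ with $J\subseteq\{1,\dots,n\}$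 and $|J|=m$. Then $\mathcal{G}_q(m,n)$ is a (left and right) noetherian domain. -/

import Mathlib

/-- The defining relations of the algebra of quantum `m × n` matrices, on the free algebra
on the letters `X (i, j)`. -/
inductive QMatRel {k : Type*} [Field k] (q : k) (m n : ℕ) :
    FreeAlgebra k (Fin m × Fin n) → FreeAlgebra k (Fin m × Fin n) → Prop
  | row (i : Fin m) (j l : Fin n) (hjl : j < l) :
      QMatRel q m n
        (FreeAlgebra.ι k (i, j) * FreeAlgebra.ι k (i, l))
        (q • (FreeAlgebra.ι k (i, l) * FreeAlgebra.ι k (i, j)))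
  | col (i r : Fin m) (j : Fin n) (hir : i < r) :
      QMatRel q m n
        (FreeAlgebra.ι k (i, j) * FreeAlgebra.ι k (r, j))
        (q • (FreeAlgebra.ι k (r, j) * FreeAlgebra.ι k (i, j)))
  | anti (i r : Fin m) (j l : Fin n) (hir : i < r) (hjl : j < l) :
      QMatRel q m n
        (FreeAlgebra.ι k (i, l) * FreeAlgebra.ι k (r, j))
        (FreeAlgebra.ι k (r, j) * FreeAlgebra.ι k (i, l))
  | diag (i r : Fin m) (j l : Fin n) (hir : i < r) (hjl : j < l) :
      QMatRel q m n
        (FreeAlgebra.ι k (i, j) * FreeAlgebra.ι k (r, l) -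
          FreeAlgebra.ι k (r, l) * FreeAlgebra.ι k (i, j))
        ((q - q⁻¹) • (FreeAlgebra.ι k (i, l) * FreeAlgebra.ι k (r, j)))

/-- The coordinate ring `O_q(M_{mn})` of quantum `m × n` matrices. -/
def QMat {k : Type*} [Field k] (q : k) (m n : ℕ) : Type _ :=
  RingQuot (QMatRel q m n)

noncomputable instance {k : Type*} [Field k] (q : k) (m n : ℕ) : Ring (QMat q m n) :=
  inferInstanceAs (Ring (RingQuot (QMatRel q m n)))

noncomputable instance {k : Type*} [Field k] (q : k) (m n : ℕ) : Algebra k (QMat q m n) :=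
  inferInstanceAs (Algebra k (RingQuot (QMatRel q m n)))

/-- The canonical generator `X_{ij}` of `O_q(M_{mn})`. -/
noncomputable def QMat.X {k : Type*} [Field k] (q : k) {m n : ℕ} (i : Fin m) (j : Fin n) :
    QMat q m n :=
  RingQuot.mkAlgHom k (QMatRel q m n) (FreeAlgebra.ι k (i, j))

/-- The length of a permutation, that is, its number of inversions. -/
def permLength {s : ℕ} (σ : Equiv.Perm (Fin s)) : ℕ :=
  (Finset.univ.filter fun p : Fin s × Fin s => p.1 < p.2 ∧ σ p.2 < σ p.1).card

/-- The `s × s` quantum minor `[I | J]`, where the index sets `I = {i_1 < ⋯ < i_s}` and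
`J = {j_1 < ⋯ < j_s}` are given by their increasing enumerations: the sum over all permutations
`σ` of `(-q)^{ℓ(σ)} X_{i_1, j_{σ(1)}} ⋯ X_{i_s, j_{σ(s)}}`. -/
noncomputable def QMat.minor {k : Type*} [Field k] (q : k) {m n s : ℕ}
    (I : Fin s ↪o Fin m) (J : Fin s ↪o Fin n) : QMat q m n :=
  ∑ σ : Equiv.Perm (Fin s),
    (-q) ^ permLength σ • (List.ofFn fun a : Fin s => QMat.X q (I a) (J (σ a))).prod

/-- The quantum grassmannian `G_q(m,n)`: the `k`-subalgebra of `O_q(M_{mn})` generated by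
the `m × m` quantum minors. -/
noncomputable def quantumGrassmannian {k : Type*} [Field k] (q : k) (m n : ℕ) :
    Subalgebra k (QMat q m n) :=
  Algebra.adjoin k
    {x | ∃ (I : Fin m ↪o Fin m) (J : Fin m ↪o Fin n), x = QMat.minor q I J}

/-! Both halves rest on one principle. Suppose an algebra is generated by finitely many elements
that commute up to a nonzero scalar and up to terms lower for a well-founded monomial order. Leading
terms then behave as in a commutative polynomial ring: by Dickson's lemma every left ideal has a
finite Gröbner basis, and if in addition the ordered monomials are linearly independent, leading
terms multiply without cancelling, so there are no zero divisors. Passing to the opposite algebra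
gives the right-handed statement.

Domain. The principle applies to the quantum matrices themselves, with `X i j` of weight `i * j`.
Independence of the ordered monomials comes from viewing them as an iterated Ore extension: reading
positions row by row, each new generator acts on polynomials over the previous algebra by `t a =
σ(a) t + δ(a)` (`StageAlg.linearIndependent_snoc`). The grassmannian is a subalgebra, so it inherits
the property.

Noetherianity. Here the generators are the maximal minors, and quasi-commutation is the hard point
(`QMat.exchange`). Take two quantum exterior algebras with letters `e j` and `f j`, braided with one
another. Quantum matrices coact on such a pair: the elements `∑ j, x i j * e j` and `∑ j, x i j * f
j` satisfy the same relations (`IsQuantumMatrix.coact`). In any braided pair the full words of both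
families commute up to `q ^ m`. Applied to the coacted pair, whose full words expand in maximal
minors, this is a generating identity for all products of two minors. Coefficients are extracted
with functionals dual to the ordered monomials, which exist by `exists_braidedPair`. Reordering
`f`-words past `e`-words is triangular for the sum of the letters, so the correction terms are
products of minors whose column sums lie further apart; a concave weight in the column sum makes
these terms lower. -/

/-! ### Algebras whose generators quasi-commute up to lower terms -/

section QuasiCommuting

variable {k A ι Γ : Type*} [Field k] [Ring A] [Algebra k A]

/-- The product of the letters of a word in the family `u`. -/
def wordProd {ι A : Type*} [Monoid A] (u : ι → A) (w : List ι) : A := (w.map u).prod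

section wordProd
variable (u : ι → A)

@[simp] lemma wordProd_nil : wordProd u [] = 1 := rfl

@[simp] lemma wordProd_cons (i : ι) (w : List ι) :
    wordProd u (i :: w) = u i * wordProd u w := by simp [wordProd]

@[simp] lemma wordProd_append (v w : List ι) :
    wordProd u (v ++ w) = wordProd u v * wordProd u w := by simp [wordProd]

lemma span_wordProd_eq_top (hu : Algebra.adjoin k (Set.range u) = ⊤) :
    Submodule.span k (Set.range (wordProd u)) = ⊤ := by
  rw [← top_le_iff, ← Algebra.top_toSubmodule, ← hu, Algebra.adjoin_eq_span, Submodule.span_le]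
  intro x hx
  refine Submodule.subset_span ?_
  induction hx using Submonoid.closure_induction with
  | mem x hx => obtain ⟨i, rfl⟩ := hx; exact ⟨[i], by simp⟩
  | one => exact ⟨[], rfl⟩
  | mul x y _ _ hx hy =>
    obtain ⟨v, rfl⟩ := hx; obtain ⟨w, rfl⟩ := hy; exact ⟨v ++ w, by simp⟩

end wordProd

variable [AddCommMonoid Γ] [LinearOrder Γ]

/-- The span of the words whose key is smaller than `γ`. -/
def lowerSpan (k : Type*) {A ι Γ : Type*} [Field k] [Ring A] [Algebra k A]
    [AddCommMonoid Γ] [LinearOrder Γ] (u : ι → A) (κ : Multiset ι →+ Γ) (γ : Γ) :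
    Submodule k A :=
  Submodule.span k {x | ∃ w : List ι, κ w < γ ∧ x = wordProd u w}

variable {u : ι → A} {κ : Multiset ι →+ Γ}

lemma wordProd_mem_lowerSpan {w : List ι} {γ : Γ} (h : κ w < γ) :
    wordProd u w ∈ lowerSpan k u κ γ :=
  Submodule.subset_span ⟨w, h, rfl⟩

lemma lowerSpan_mono {γ γ' : Γ} (h : γ ≤ γ') : lowerSpan k u κ γ ≤ lowerSpan k u κ γ' :=
  Submodule.span_mono fun _ ⟨w, hw, hx⟩ => ⟨w, hw.trans_le h, hx⟩

/-- The letters quasi-commute modulo words with smaller key. -/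
def QuasiCommutes (k : Type*) {A ι Γ : Type*} [Field k] [Ring A] [Algebra k A]
    [AddCommMonoid Γ] [LinearOrder Γ] (u : ι → A) (κ : Multiset ι →+ Γ) : Prop :=
  ∀ i j, ∃ c : k, c ≠ 0 ∧ u i * u j - c • (u j * u i) ∈ lowerSpan k u κ (κ {i, j})

lemma op_mem_lowerSpan {x : A} {γ : Γ} (hx : x ∈ lowerSpan k u κ γ) :
    MulOpposite.op x ∈ lowerSpan k (fun i => MulOpposite.op (u i)) κ γ := by
  induction hx using Submodule.span_induction with
  | mem x hx =>
    obtain ⟨w, hw, rfl⟩ := hx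
    refine Submodule.subset_span ⟨w.reverse, by simpa using hw, ?_⟩
    simp [wordProd, MulOpposite.op_list_prod, List.map_map, Function.comp_def]
  | zero => simp
  | add x y _ _ hx hy => rw [MulOpposite.op_add]; exact add_mem hx hy
  | smul c x _ hx => rw [MulOpposite.op_smul]; exact Submodule.smul_mem _ _ hx

/-- Reversing a word does not change its multiset of letters, hence not its key. This is what turns
the left noetherian property into the right one. -/
lemma QuasiCommutes.op (H : QuasiCommutes k u κ) :
    QuasiCommutes k (fun i => MulOpposite.op (u i)) κ := by
  intro i j
  obtain ⟨c, hc, h⟩ := H j i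
  refine ⟨c, hc, ?_⟩
  have := op_mem_lowerSpan h
  rw [Multiset.pair_comm] at this
  simpa using this

lemma adjoin_range_op (hu : Algebra.adjoin k (Set.range u) = ⊤) :
    Algebra.adjoin k (Set.range fun i => MulOpposite.op (u i)) = ⊤ := by
  rw [← top_le_iff]
  intro x _
  have hx : x.unop ∈ Algebra.adjoin k (Set.range u) := by rw [hu]; trivial
  rw [← MulOpposite.op_unop x]
  generalize x.unop = y at hx
  induction hx using Algebra.adjoin_induction with
  | mem y hy =>
    obtain ⟨i, rfl⟩ := hy
    exact Algebra.subset_adjoin ⟨i, rfl⟩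
  | algebraMap r => exact Subalgebra.algebraMap_mem _ r
  | add y z _ _ hy hz => rw [MulOpposite.op_add]; exact add_mem hy hz
  | mul y z _ _ hy hz => rw [MulOpposite.op_mul]; exact mul_mem hz hy

lemma exists_mem_lowerSpan (hu : Algebra.adjoin k (Set.range u) = ⊤)
    (hΓ : ∀ γ : Γ, ∃ γ', γ < γ') (x : A) :
    ∃ γ, x ∈ lowerSpan k u κ γ := by
  have hx : x ∈ Submodule.span k (Set.range (wordProd u)) := by
    rw [span_wordProd_eq_top u hu]; trivial
  induction hx using Submodule.span_induction with
  | mem x hx =>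
    obtain ⟨w, rfl⟩ := hx
    obtain ⟨γ, hγ⟩ := hΓ (κ w)
    exact ⟨γ, wordProd_mem_lowerSpan hγ⟩
  | zero => exact ⟨0, zero_mem _⟩
  | add x y _ _ hx hy =>
    obtain ⟨γ, h⟩ := hx
    obtain ⟨γ', h'⟩ := hy
    exact ⟨max γ γ', add_mem (lowerSpan_mono (le_max_left _ _) h)
      (lowerSpan_mono (le_max_right _ _) h')⟩
  | smul c x _ hx => obtain ⟨γ, h⟩ := hx; exact ⟨γ, Submodule.smul_mem _ _ h⟩

variable [IsOrderedCancelAddMonoid Γ]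

lemma wordProd_mul_mem_lowerSpan (v : List ι) {x : A} {γ : Γ} (hx : x ∈ lowerSpan k u κ γ) :
    wordProd u v * x ∈ lowerSpan k u κ (κ v + γ) := by
  induction hx using Submodule.span_induction with
  | mem x hx =>
    obtain ⟨w, hw, rfl⟩ := hx
    rw [← wordProd_append]
    apply wordProd_mem_lowerSpan
    rw [← Multiset.coe_add, map_add]
    gcongr
  | zero => simp
  | add x y _ _ hx hy => rw [mul_add]; exact add_mem hx hy
  | smul c x _ hx => rw [mul_smul_comm]; exact Submodule.smul_mem _ _ hx

lemma mul_wordProd_mem_lowerSpan (v : List ι) {x : A} {γ : Γ} (hx : x ∈ lowerSpan k u κ γ) :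
    x * wordProd u v ∈ lowerSpan k u κ (γ + κ v) := by
  induction hx using Submodule.span_induction with
  | mem x hx =>
    obtain ⟨w, hw, rfl⟩ := hx
    rw [← wordProd_append]
    apply wordProd_mem_lowerSpan
    rw [← Multiset.coe_add, map_add]
    gcongr
  | zero => simp
  | add x y _ _ hx hy => rw [add_mul]; exact add_mem hx hy
  | smul c x _ hx => rw [smul_mul_assoc]; exact Submodule.smul_mem _ _ hx

lemma mul_mem_lowerSpan {x y : A} {γ γ' : Γ} (hx : x ∈ lowerSpan k u κ γ)
    (hy : y ∈ lowerSpan k u κ γ') : x * y ∈ lowerSpan k u κ (γ + γ') := by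
  induction hx using Submodule.span_induction with
  | mem x hx =>
    obtain ⟨w, hw, rfl⟩ := hx
    refine lowerSpan_mono ?_ (wordProd_mul_mem_lowerSpan w hy)
    gcongr
  | zero => simp
  | add x z _ _ hx hz => rw [add_mul]; exact add_mem hx hz
  | smul c x _ hx => rw [smul_mul_assoc]; exact Submodule.smul_mem _ _ hx

/-- Each adjacent transposition costs a nonzero scalar and an error of lower key. Since the key
depends only on the multiset of letters, the errors of successive transpositions stay below the same
bound. -/
lemma QuasiCommutes.perm (H : QuasiCommutes k u κ) {v w : List ι} (h : v.Perm w) :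
    ∃ c : k, c ≠ 0 ∧ wordProd u v - c • wordProd u w ∈ lowerSpan k u κ (κ v) := by
  induction h with
  | nil => exact ⟨1, one_ne_zero, by simp⟩
  | @cons a v w _ ih =>
    obtain ⟨c, hc, h⟩ := ih
    refine ⟨c, hc, ?_⟩
    have := wordProd_mul_mem_lowerSpan [a] h
    rw [← map_add, Multiset.coe_add] at this
    simpa [mul_sub] using this
  | swap a b v =>
    obtain ⟨c, hc, h⟩ := H b a
    refine ⟨c, hc, ?_⟩
    have := mul_wordProd_mem_lowerSpan v h
    rw [← map_add] at this
    simpa [sub_mul, mul_assoc] using this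
  | @trans v w x hvw _ ih₁ ih₂ =>
    obtain ⟨c, hc, h₁⟩ := ih₁
    obtain ⟨d, hd, h₂⟩ := ih₂
    refine ⟨c * d, mul_ne_zero hc hd, ?_⟩
    rw [← Multiset.coe_eq_coe.2 hvw] at h₂
    have := add_mem h₁ (Submodule.smul_mem _ c h₂)
    rwa [smul_sub, sub_add_sub_cancel, smul_smul] at this

/-- In a sum, the larger leading word survives. If the keys agree, injectivity of `κ` makes the two
words permutations of each other, so one is rewritten through the other and the coefficients add.
They may cancel, so `c = 0` is allowed here and is removed later by descent on the key. -/
lemma QuasiCommutes.exists_leading (H : QuasiCommutes k u κ) (hκ : Function.Injective κ)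
    {γ : Γ} {x : A} (hx : x ∈ lowerSpan k u κ γ) :
    x = 0 ∨ ∃ w : List ι, κ w < γ ∧ ∃ c : k,
      x - c • wordProd u w ∈ lowerSpan k u κ (κ w) := by
  induction hx using Submodule.span_induction with
  | mem x hx =>
    obtain ⟨w, hw, rfl⟩ := hx
    exact .inr ⟨w, hw, 1, by simp⟩
  | zero => exact .inl rfl
  | add x y _ _ hx hy =>
    obtain rfl | ⟨v, hv, c, hc⟩ := hx
    · simpa using hy
    obtain rfl | ⟨w, hw, d, hd⟩ := hy
    · rw [add_zero]; exact .inr ⟨v, hv, c, hc⟩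
    right
    have key : ∀ (x : A) (v w : List ι) (c : k), κ v < κ w →
        x - c • wordProd u v ∈ lowerSpan k u κ (κ v) → x ∈ lowerSpan k u κ (κ w) := by
      intro x v w c hlt hc
      have := add_mem (lowerSpan_mono hlt.le hc)
        (Submodule.smul_mem _ c (wordProd_mem_lowerSpan (k := k) (u := u) hlt))
      simpa using this
    rcases lt_trichotomy (κ v) (κ w) with hlt | heq | hlt
    · refine ⟨w, hw, d, ?_⟩
      rw [add_sub_assoc]
      exact add_mem (key x v w c hlt hc) hd
    · obtain ⟨a, -, ha⟩ := H.perm (Multiset.coe_eq_coe.1 (hκ heq))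
      refine ⟨w, hw, c * a + d, ?_⟩
      rw [heq] at hc ha
      have := add_mem (add_mem hc (Submodule.smul_mem _ c ha)) hd
      convert this using 1
      module
    · refine ⟨v, hv, c, ?_⟩
      rw [add_comm x y, add_sub_assoc]
      exact add_mem (key y w v d hlt hd) hc
  | smul a x _ hx =>
    obtain rfl | ⟨v, hv, c, hc⟩ := hx
    · simp
    · refine .inr ⟨v, hv, a * c, ?_⟩
      rw [mul_smul, ← smul_sub]
      exact Submodule.smul_mem _ _ hc

lemma QuasiCommutes.exists_leading_of_ne_zero [WellFoundedLT Γ] (H : QuasiCommutes k u κ)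
    (hκ : Function.Injective κ) (hu : Algebra.adjoin k (Set.range u) = ⊤)
    (hΓ : ∀ γ : Γ, ∃ γ', γ < γ') {x : A} (hx : x ≠ 0) :
    ∃ w : List ι, ∃ c : k, c ≠ 0 ∧ x - c • wordProd u w ∈ lowerSpan k u κ (κ w) := by
  obtain ⟨γ, hγ⟩ := exists_mem_lowerSpan (κ := κ) hu hΓ x
  induction γ using WellFoundedLT.induction with
  | ind γ ih =>
    obtain h | ⟨w, hw, c, hc⟩ := H.exists_leading hκ hγ
    · exact absurd h hx
    · by_cases h0 : c = 0
      · subst h0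
        exact ih _ hw (by simpa using hc)
      · exact ⟨w, c, h0, hc⟩

/-- Dickson's lemma: multisets on a finite type are well quasi-ordered, so the minimal elements of
`S`, which form an antichain, are finite in number. -/
lemma exists_finset_le_of_mem [Finite ι] (S : Set (Multiset ι)) :
    ∃ B : Finset (Multiset ι), ↑B ⊆ S ∧ ∀ s ∈ S, ∃ b ∈ B, b ≤ s := by
  classical
  have : WellQuasiOrderedLE (Multiset ι) :=
    (OrderIso.wellQuasiOrderedLE_iff (Finsupp.orderIsoMultiset (ι := ι))).1 inferInstance
  have hfin := WellQuasiOrderedLE.finite_of_isAntichain (setOfPred_minimal_antichain (· ∈ S))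
  refine ⟨hfin.toFinset, fun b hb => ?_, fun s hs => ?_⟩
  · have : Minimal (· ∈ S) b := by simpa using hb
    exact this.prop
  · obtain ⟨b, hb, hm⟩ := exists_minimal_le_of_wellFoundedLT (· ∈ S) s hs
    exact ⟨b, by simpa using hm, hb⟩

/-- An algebra generated by finitely many elements which quasi-commute up to lower terms is
left noetherian. -/
theorem QuasiCommutes.isNoetherianRing [Finite ι] [WellFoundedLT Γ] (H : QuasiCommutes k u κ)
    (hκ : Function.Injective κ) (hu : Algebra.adjoin k (Set.range u) = ⊤)
    (hΓ : ∀ γ : Γ, ∃ γ', γ < γ') : IsNoetherianRing A := by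
  refine ⟨fun I => ?_⟩
  -- The set is that of the leading multisets of elements of `I`, normalised to leading coefficient
  -- one; `B` indexes a Gröbner basis `g`.
  obtain ⟨B, hBS, hB⟩ := exists_finset_le_of_mem
    {s : Multiset ι | ∃ x ∈ I, ∃ w : List ι, (w : Multiset ι) = s ∧
      x - wordProd u w ∈ lowerSpan k u κ (κ s)}
  have hBS' : ∀ b ∈ B, ∃ (x : A) (w : List ι), x ∈ I ∧ (w : Multiset ι) = b ∧
      x - wordProd u w ∈ lowerSpan k u κ (κ b) := fun b hb => by
    obtain ⟨x, hx, w, hw, h⟩ := hBS hb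
    exact ⟨x, w, hx, hw, h⟩
  choose! g v hgI hv hg using hBS'
  have hsmul : ∀ (c : k) {x : A} {J : Submodule A A}, x ∈ J → c • x ∈ J := fun c x J hx => by
    rw [← one_smul A x, ← smul_assoc]
    exact J.smul_mem _ hx
  have main : ∀ γ, ∀ x ∈ I, x ∈ lowerSpan k u κ γ → x ∈ Submodule.span A (g '' B) := by
    intro γ
    induction γ using WellFoundedLT.induction with
    | ind γ ih =>
      intro x hxI hx
      obtain rfl | ⟨w, hw, c, hc⟩ := H.exists_leading hκ hx
      · exact zero_mem _
      by_cases h0 : c = 0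
      · subst h0
        exact ih _ hw x hxI (by simpa using hc)
      obtain ⟨b, hbB, hbw⟩ := hB (w : Multiset ι) ⟨c⁻¹ • x, hsmul _ hxI, w, rfl, by
        have := Submodule.smul_mem _ c⁻¹ hc
        rwa [smul_sub, smul_smul, inv_mul_cancel₀ h0, one_smul] at this⟩
      obtain ⟨t, ht⟩ := Multiset.le_iff_exists_add.1 hbw
      have hperm : (t.toList ++ v b).Perm w := by
        rw [← Multiset.coe_eq_coe, ← Multiset.coe_add, Multiset.coe_toList, hv b hbB, ht, add_comm]
      obtain ⟨d, hd, hdw⟩ := H.perm hperm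
      have h1 := wordProd_mul_mem_lowerSpan t.toList (hg b hbB)
      rw [← map_add, Multiset.coe_toList, add_comm, ← ht, mul_sub, ← wordProd_append] at h1
      rw [Multiset.coe_eq_coe.2 hperm] at hdw
      -- One reduction step: the word `t` supplies the letters of `w` missing from `b`, so `wordProd
      -- u t.toList * g b` has leading word `w` up to the scalar `d` and cancels the leading term of
      -- `x`.
      have h2 : x - (c * d⁻¹) • (wordProd u t.toList * g b) ∈ lowerSpan k u κ (κ w) := by
        have := sub_mem hc (Submodule.smul_mem _ (c * d⁻¹) (add_mem h1 hdw))
        convert this using 1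
        rw [sub_add_sub_cancel, smul_sub, smul_smul, inv_mul_cancel_right₀ hd]
        abel
      have h3 := ih _ hw _ (sub_mem hxI (hsmul _ (I.smul_mem _ (hgI b hbB)))) h2
      have h4 : (c * d⁻¹) • (wordProd u t.toList * g b) ∈ Submodule.span A (g '' B) :=
        hsmul _ (Submodule.smul_mem _ _ (Submodule.subset_span ⟨b, hbB, rfl⟩))
      simpa using add_mem h3 h4
  have hI : I = Submodule.span A (g '' B) := by
    apply le_antisymm
    · intro x hx
      obtain ⟨γ, hγ⟩ := exists_mem_lowerSpan (κ := κ) hu hΓ x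
      exact main γ x hx hγ
    · rw [Submodule.span_le]
      rintro _ ⟨b, hb, rfl⟩
      exact hgI b hb
  rw [hI]
  exact Submodule.fg_span (B.finite_toSet.image g)

/-- Every word is a multiple of the chosen ordering of its letters plus lower words, and the latter
are handled by well-founded induction. -/
lemma QuasiCommutes.lowerSpan_le [WellFoundedLT Γ] (H : QuasiCommutes k u κ)
    {rep : Multiset ι → List ι} (hrep : ∀ s, (rep s : Multiset ι) = s) (γ : Γ) :
    lowerSpan k u κ γ ≤
      Submodule.span k ((fun s => wordProd u (rep s)) '' {s | κ s < γ}) := by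
  induction γ using WellFoundedLT.induction with
  | ind γ ih =>
    refine Submodule.span_le.2 ?_
    rintro _ ⟨w, hw, rfl⟩
    obtain ⟨c, -, hc⟩ := H.perm (v := w) (w := rep w) (Multiset.coe_eq_coe.1 (hrep w).symm)
    have h1 : _ ∈ Submodule.span k ((fun s => wordProd u (rep s)) '' {s | κ s < γ}) :=
      Submodule.span_mono
        (Set.image_mono (fun s (hs : κ s < κ w) => hs.trans hw)) (ih _ hw hc)
    have h2 := Submodule.smul_mem _ c (Submodule.subset_span (R := k)
      (Set.mem_image_of_mem (fun s => wordProd u (rep s))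
        (show (w : Multiset ι) ∈ {s | κ s < γ} from hw)))
    simpa using add_mem h1 h2

/-- If moreover the monomials are linearly independent, the algebra has no zero divisors. -/
theorem QuasiCommutes.noZeroDivisors [WellFoundedLT Γ] (H : QuasiCommutes k u κ)
    (hκ : Function.Injective κ) (hu : Algebra.adjoin k (Set.range u) = ⊤)
    (hΓ : ∀ γ : Γ, ∃ γ', γ < γ') {rep : Multiset ι → List ι}
    (hrep : ∀ s, (rep s : Multiset ι) = s)
    (hli : LinearIndependent k fun s => wordProd u (rep s)) : NoZeroDivisors A := by
  refine ⟨fun {x y} hxy => ?_⟩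
  by_contra! hne
  obtain ⟨v, c, hc, hv⟩ := H.exists_leading_of_ne_zero hκ hu hΓ hne.1
  obtain ⟨w, d, hd, hw⟩ := H.exists_leading_of_ne_zero hκ hu hΓ hne.2
  set s : Multiset ι := ↑(v ++ w) with hs
  have hκs : κ s = κ v + κ w := by rw [hs, ← Multiset.coe_add, map_add]
  -- The product of the leading terms differs from `x * y = 0` by lower terms only, so the leading
  -- monomial itself would be a combination of smaller ones.
  have h1 : (c * d) • wordProd u (v ++ w) ∈ lowerSpan k u κ (κ s) := by
    have e : (c * d) • wordProd u (v ++ w) = -((x - c • wordProd u v) * (y - d • wordProd u w)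
        + c • (wordProd u v * (y - d • wordProd u w))
        + d • ((x - c • wordProd u v) * wordProd u w)) + x * y := by
      simp only [wordProd_append, mul_sub, sub_mul, smul_sub, smul_mul_assoc, mul_smul_comm]
      module
    rw [e, hxy, add_zero, hκs]
    exact neg_mem (add_mem (add_mem (mul_mem_lowerSpan hv hw)
      (Submodule.smul_mem _ _ (wordProd_mul_mem_lowerSpan v hw)))
      (Submodule.smul_mem _ _ (mul_wordProd_mem_lowerSpan w hv)))
  obtain ⟨a, ha, h2⟩ := H.perm (v := rep s) (w := v ++ w) (Multiset.coe_eq_coe.1 (hrep s))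
  rw [hrep] at h2
  have h3 : wordProd u (rep s) ∈ lowerSpan k u κ (κ s) := by
    have := add_mem h2 (Submodule.smul_mem _ (a * (c * d)⁻¹) h1)
    rwa [smul_smul, inv_mul_cancel_right₀ (mul_ne_zero hc hd), sub_add_cancel] at this
  exact hli.notMem_span_image (s := {t | κ t < κ s}) (x := s) (by simp)
    (H.lowerSpan_le hrep _ h3)

end QuasiCommuting

/-! ### Monomial orders obtained from a weight on the letters -/

section Weighted

variable {k A ι : Type*} [Field k] [Ring A] [Algebra k A]

/-- Compare multisets first by weight, then lexicographically. -/
noncomputable def weightKey [LinearOrder ι] (wt : ι → ℕ) :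
    Multiset ι →+ ℕ ×ₗ Lex (ι →₀ ℕ) where
  toFun s := toLex ((s.map wt).sum, toLex (Multiset.toFinsupp s))
  map_zero' := by simp
  map_add' s t := by simp; rfl

lemma weightKey_injective [LinearOrder ι] (wt : ι → ℕ) : Function.Injective (weightKey wt) := by
  intro s t h
  have := congrArg (fun x => ofLex (ofLex x).2) h
  exact Multiset.toFinsupp.injective this

lemma exists_weightKey_lt [LinearOrder ι] (γ : ℕ ×ₗ Lex (ι →₀ ℕ)) : ∃ γ', γ < γ' :=
  ⟨toLex ((ofLex γ).1 + 1, (ofLex γ).2), Prod.Lex.lt_iff.2 (.inl (Nat.lt_succ_self _))⟩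

/-- The generators quasi-commute modulo products of two generators of smaller weight. -/
def WeightedQuasiCommutes (k : Type*) {A ι : Type*} [Field k] [Ring A] [Algebra k A]
    (u : ι → A) (wt : ι → ℕ) : Prop :=
  ∀ i j, ∃ c : k, c ≠ 0 ∧ u i * u j - c • (u j * u i) ∈
    Submodule.span k {x | ∃ a b, wt a + wt b < wt i + wt j ∧ x = u a * u b}

lemma WeightedQuasiCommutes.quasiCommutes [LinearOrder ι] {u : ι → A} {wt : ι → ℕ}
    (H : WeightedQuasiCommutes k u wt) : QuasiCommutes k u (weightKey wt) := by
  intro i j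
  obtain ⟨c, hc, h⟩ := H i j
  refine ⟨c, hc, Submodule.span_mono ?_ h⟩
  rintro _ ⟨a, b, hab, rfl⟩
  refine ⟨[a, b], Prod.Lex.lt_iff.2 (.inl ?_), by simp⟩
  simpa [weightKey] using hab

theorem WeightedQuasiCommutes.isNoetherianRing [Finite ι] {u : ι → A} {wt : ι → ℕ}
    (H : WeightedQuasiCommutes k u wt) (hu : Algebra.adjoin k (Set.range u) = ⊤) :
    IsNoetherianRing A ∧ IsNoetherianRing Aᵐᵒᵖ := by
  obtain ⟨n, ⟨e⟩⟩ := Finite.exists_equiv_fin ι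
  -- The order on the letters is arbitrary: it only breaks ties between words of equal weight, so
  -- that the key is injective.
  let _ : LinearOrder ι := LinearOrder.lift' e e.injective
  exact ⟨H.quasiCommutes.isNoetherianRing (weightKey_injective wt) hu exists_weightKey_lt,
    H.quasiCommutes.op.isNoetherianRing (weightKey_injective wt) (adjoin_range_op hu)
      exists_weightKey_lt⟩

theorem WeightedQuasiCommutes.noZeroDivisors [Finite ι] {u : ι → A} {wt : ι → ℕ}
    (H : WeightedQuasiCommutes k u wt) (hu : Algebra.adjoin k (Set.range u) = ⊤)
    {rep : Multiset ι → List ι} (hrep : ∀ s, (rep s : Multiset ι) = s)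
    (hli : LinearIndependent k fun s => wordProd u (rep s)) : NoZeroDivisors A := by
  obtain ⟨n, ⟨e⟩⟩ := Finite.exists_equiv_fin ι
  let _ : LinearOrder ι := LinearOrder.lift' e e.injective
  exact H.quasiCommutes.noZeroDivisors (weightKey_injective wt) hu exists_weightKey_lt hrep hli

end Weighted

/-! ### The domain property of quantum matrices -/

section OreStep

variable {k : Type*} [Field k]
set_option linter.unusedSimpArgs false
set_option linter.unnecessarySeqFocus false

/-- A family satisfies the relations of quantum matrices among the positions in `S`. -/
structure IsQuantumMatrix (q : k) {α β A : Type*} [LT α] [LT β] [Ring A] [Algebra k A]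
    (S : α → β → Prop) (x : α → β → A) : Prop where
  row : ∀ {i j l}, j < l → S i j → S i l → x i j * x i l = q • (x i l * x i j)
  col : ∀ {i r j}, i < r → S i j → S r j → x i j * x r j = q • (x r j * x i j)
  anti : ∀ {i r j l}, i < r → j < l → S i l → S r j → x i l * x r j = x r j * x i l
  diag : ∀ {i r j l}, i < r → j < l → S i j → S i l → S r j → S r l →
    x i j * x r l = x r l * x i j + (q - q⁻¹) • (x r j * x i l)

/-- The image of the entry at `(i, j)` under the twisting automorphism of the entry at
`(r, l)`. -/
def oreTwist (q : k) {A : Type*} [Ring A] [Algebra k A] (x : ℕ → ℕ → A) (r l i j : ℕ) : A :=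
  if i = r ∨ j = l then q⁻¹ • x i j else x i j

/-- The image of the entry at `(i, j)` under the skew derivation of the entry at `(r, l)`. -/
def oreDer (q : k) {A : Type*} [Ring A] [Algebra k A] (x : ℕ → ℕ → A) (r l i j : ℕ) : A :=
  if i < r ∧ j < l then -(q - q⁻¹) • (x r j * x i l) else 0

/-- The upper triangular matrix combining twist, derivation and identity. -/
def oreMatrix (q : k) {A : Type*} [Ring A] [Algebra k A] (x : ℕ → ℕ → A) (r l i j : ℕ) :
    Matrix (Fin 2) (Fin 2) A :=
  !![oreTwist q x r l i j, oreDer q x r l i j; 0, x i j]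

/-- The positions in `S` precede `(r, l)` lexicographically and are closed under passing to the
other two corners of a rectangle with corner `(r, l)`. -/
structure Precedes (S : ℕ → ℕ → Prop) (r l : ℕ) : Prop where
  lex : ∀ {i j}, S i j → i < r ∨ i = r ∧ j < l
  right : ∀ {i j}, S i j → i < r → S i l
  left : ∀ {i j}, S i j → j < l → S r j
  cross : ∀ {i j i' j'}, S i j → S i' j' → i < r → S i j'

variable {q : k} {A : Type*} [Ring A] [Algebra k A] {S : ℕ → ℕ → Prop} {x : ℕ → ℕ → A}
  {r l : ℕ}


section assoc
variable (hx : IsQuantumMatrix q S x) {i j i' j' : ℕ}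
include hx

lemma IsQuantumMatrix.row_assoc (h : j < j') (h1 : S i j) (h2 : S i j') (z : A) :
    x i j * (x i j' * z) = q • (x i j' * (x i j * z)) := by
  rw [← mul_assoc, hx.row h h1 h2, smul_mul_assoc, mul_assoc]

lemma IsQuantumMatrix.col_assoc (h : i < i') (h1 : S i j) (h2 : S i' j) (z : A) :
    x i j * (x i' j * z) = q • (x i' j * (x i j * z)) := by
  rw [← mul_assoc, hx.col h h1 h2, smul_mul_assoc, mul_assoc]

/-- The scalar `1` keeps `simp` from treating this as an ordered rewrite rule. -/
lemma IsQuantumMatrix.anti_smul (h : i < i') (h' : j < j') (h1 : S i j') (h2 : S i' j) :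
    x i j' * x i' j = (1 : k) • (x i' j * x i j') := by
  rw [hx.anti h h' h1 h2, one_smul]

lemma IsQuantumMatrix.anti_assoc (h : i < i') (h' : j < j') (h1 : S i j') (h2 : S i' j) (z : A) :
    x i j' * (x i' j * z) = (1 : k) • (x i' j * (x i j' * z)) := by
  rw [← mul_assoc, hx.anti h h' h1 h2, mul_assoc, one_smul]

lemma IsQuantumMatrix.diag_assoc (h : i < i') (h' : j < j') (h1 : S i j) (h2 : S i j')
    (h3 : S i' j) (h4 : S i' j') (z : A) :
    x i j * (x i' j' * z) =
      x i' j' * (x i j * z) + (q - q⁻¹) • (x i' j * (x i j' * z)) := by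
  rw [← mul_assoc, hx.diag h h' h1 h2 h3 h4, add_mul, smul_mul_assoc, mul_assoc, mul_assoc]

end assoc

section eval
variable {i j : ℕ}

lemma oreTwist_left (hi : i < r) (hj : j < l) : oreTwist q x r l i j = x i j := by
  simp [oreTwist, hi.ne, hj.ne]

lemma oreTwist_right (hi : i < r) (hj : l < j) : oreTwist q x r l i j = x i j := by
  simp [oreTwist, hi.ne, hj.ne']

lemma oreTwist_same_col : oreTwist q x r l i l = q⁻¹ • x i l := by simp [oreTwist]

lemma oreTwist_same_row : oreTwist q x r l r j = q⁻¹ • x r j := by simp [oreTwist]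

lemma oreDer_left (hi : i < r) (hj : j < l) :
    oreDer q x r l i j = -(q - q⁻¹) • (x r j * x i l) := by simp [oreDer, hi, hj]

lemma oreDer_right (hj : l < j) : oreDer q x r l i j = 0 := by simp [oreDer, hj.not_gt]

lemma oreDer_same_col : oreDer q x r l i l = 0 := by simp [oreDer]

lemma oreDer_same_row : oreDer q x r l r j = 0 := by simp [oreDer]

end eval

lemma IsQuantumMatrix.oreTwist_row (hx : IsQuantumMatrix q S x)
    {i j j' : ℕ} (h : j < j') (h1 : S i j) (h2 : S i j') :
    oreTwist q x r l i j * oreTwist q x r l i j' =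
        q • (oreTwist q x r l i j' * oreTwist q x r l i j) := by
  have h3 := hx.row h h1 h2
  unfold oreTwist
  split_ifs <;> simp only [smul_mul_assoc, mul_smul_comm, h3] <;> module

lemma IsQuantumMatrix.oreTwist_col (hx : IsQuantumMatrix q S x)
    {i i' j : ℕ} (h : i < i') (h1 : S i j) (h2 : S i' j) :
    oreTwist q x r l i j * oreTwist q x r l i' j =
        q • (oreTwist q x r l i' j * oreTwist q x r l i j) := by
  have h3 := hx.col h h1 h2
  unfold oreTwist
  split_ifs <;> simp only [smul_mul_assoc, mul_smul_comm, h3] <;> module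

lemma IsQuantumMatrix.oreTwist_anti (hx : IsQuantumMatrix q S x)
    {i i' j j' : ℕ} (h : i < i') (h' : j < j') (h1 : S i j') (h2 : S i' j) :
    oreTwist q x r l i j' * oreTwist q x r l i' j =
        oreTwist q x r l i' j * oreTwist q x r l i j' := by
  have h3 := hx.anti h h' h1 h2
  unfold oreTwist
  split_ifs <;> simp only [smul_mul_assoc, mul_smul_comm, h3]

/-- Both sides pick up the same power of `q⁻¹`, as each product uses the same two rows and columns.
Only the position `(r, l)`, lying on both the twisted row and the twisted column, could spoil the
count; `Precedes` keeps it out of the rectangle. -/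
lemma IsQuantumMatrix.oreTwist_diag (hx : IsQuantumMatrix q S x) (hS : Precedes S r l)
    {i i' j j' : ℕ} (h : i < i') (h' : j < j') (h1 : S i j) (h2 : S i j') (h3 : S i' j)
    (h4 : S i' j') :
    oreTwist q x r l i j * oreTwist q x r l i' j' =
      oreTwist q x r l i' j' * oreTwist q x r l i j +
        (q - q⁻¹) • (oreTwist q x r l i' j * oreTwist q x r l i j') := by
  have h5 := hx.diag h h' h1 h2 h3 h4
  have h6 := hS.lex h4
  unfold oreTwist
  split_ifs <;> first
    | (exfalso; omega)
    | (simp only [smul_mul_assoc, mul_smul_comm, h5] <;> module)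

/-- This and the next three lemmas say that the twisted Leibniz rule respects the defining
relations. The derivation is nonzero only strictly above and to the left of `(r, l)`, whence the
case distinction. In each case both sides are rewritten into monomials decreasing for the
lexicographic order of positions and their scalars compared; `Precedes` ensures that the positions
that arise lie in `S`. -/
lemma IsQuantumMatrix.oreDer_row (hq : q ≠ 0) (hx : IsQuantumMatrix q S x)
    (hS : Precedes S r l) {i j j' : ℕ} (h : j < j') (h1 : S i j) (h2 : S i j') :
    oreTwist q x r l i j * oreDer q x r l i j' + oreDer q x r l i j * x i j' =
      q • (oreTwist q x r l i j' * oreDer q x r l i j + oreDer q x r l i j' * x i j) := by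
  rcases hS.lex h1 with hi | ⟨rfl, hj⟩
  · have h3 := hS.right h1 hi
    rcases lt_trichotomy j' l with hl | rfl | hl
    · have hj := h.trans hl
      have h4 := hS.left h1 hj
      have h5 := hS.left h2 hl
      simp only [h, h1, h2, h3, h4, h5, hi, hj, hl, oreTwist_left,
        oreTwist_right, oreTwist_same_col,
        oreTwist_same_row, oreDer_left, oreDer_right, oreDer_same_col, oreDer_same_row,
        mul_zero, zero_mul, add_zero, zero_add, smul_zero, mul_assoc, smul_mul_assoc, mul_smul_comm,
        hx.row, hx.col, hx.anti_smul, hx.diag,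
        hx.row_assoc, hx.col_assoc, hx.anti_assoc, hx.diag_assoc,
        add_mul, mul_add, smul_add, smul_smul]
      match_scalars <;> field_simp <;> ring
    · have h4 := hS.left h1 h
      simp only [h, h1, h2, h3, h4, hi, oreTwist_left,
        oreTwist_right, oreTwist_same_col,
        oreTwist_same_row, oreDer_left, oreDer_right, oreDer_same_col, oreDer_same_row,
        mul_zero, zero_mul, add_zero, zero_add, smul_zero, mul_assoc, smul_mul_assoc, mul_smul_comm,
        hx.row, hx.col, hx.anti_smul, hx.diag,
        hx.row_assoc, hx.col_assoc, hx.anti_assoc, hx.diag_assoc,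
        add_mul, mul_add, smul_add, smul_smul]
      match_scalars <;> field_simp
    · rcases lt_trichotomy j l with hj | rfl | hj
      · have h4 := hS.left h1 hj
        simp only [h, h1, h2, h3, h4, hi, hj, hl, oreTwist_left,
        oreTwist_right, oreTwist_same_col,
          oreTwist_same_row, oreDer_left, oreDer_right, oreDer_same_col, oreDer_same_row,
          mul_zero, zero_mul, add_zero, zero_add, smul_zero, mul_assoc, smul_mul_assoc, mul_smul_comm,
          hx.row, hx.col, hx.anti_smul, hx.diag,
          hx.row_assoc, hx.col_assoc, hx.anti_assoc, hx.diag_assoc,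
          add_mul, mul_add, smul_add, smul_smul]
        match_scalars <;> field_simp
      · simp only [oreDer_same_col, oreDer_right hl, mul_zero, zero_mul, add_zero, smul_zero]
      · simp only [oreDer_right hj, oreDer_right hl, mul_zero, zero_mul, add_zero, smul_zero]
  · simp only [oreDer_same_row, mul_zero, zero_mul, add_zero, smul_zero]

lemma IsQuantumMatrix.oreDer_col (hq : q ≠ 0) (hx : IsQuantumMatrix q S x)
    (hS : Precedes S r l) {i i' j : ℕ} (h : i < i') (h1 : S i j) (h2 : S i' j) :
    oreTwist q x r l i j * oreDer q x r l i' j + oreDer q x r l i j * x i' j =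
      q • (oreTwist q x r l i' j * oreDer q x r l i j + oreDer q x r l i' j * x i j) := by
  rcases lt_trichotomy j l with hj | rfl | hj
  · have h3 := hS.left h1 hj
    rcases hS.lex h2 with hi' | ⟨rfl, -⟩
    · have hi := h.trans hi'
      have h4 := hS.right h1 hi
      have h5 := hS.right h2 hi'
      simp only [h, h1, h2, h3, h4, h5, hi, hi', hj, oreTwist_left,
        oreTwist_right, oreTwist_same_col,
        oreTwist_same_row, oreDer_left, oreDer_right, oreDer_same_col, oreDer_same_row,
        mul_zero, zero_mul, add_zero, zero_add, smul_zero, mul_assoc, smul_mul_assoc, mul_smul_comm,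
        hx.row, hx.col, hx.anti_smul, hx.diag,
        hx.row_assoc, hx.col_assoc, hx.anti_assoc, hx.diag_assoc,
        add_mul, mul_add, smul_add, smul_smul]
      match_scalars <;> field_simp <;> ring
    · have h4 := hS.right h1 h
      simp only [h, h1, h2, h3, h4, hj, oreTwist_left,
        oreTwist_right, oreTwist_same_col,
        oreTwist_same_row, oreDer_left, oreDer_right, oreDer_same_col, oreDer_same_row,
        mul_zero, zero_mul, add_zero, zero_add, smul_zero, mul_assoc, smul_mul_assoc, mul_smul_comm,
        hx.row, hx.col, hx.anti_smul, hx.diag,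
        hx.row_assoc, hx.col_assoc, hx.anti_assoc, hx.diag_assoc,
        add_mul, mul_add, smul_add, smul_smul]
      match_scalars <;> field_simp
  · simp only [oreDer_same_col, mul_zero, zero_mul, add_zero, smul_zero]
  · simp only [oreDer_right hj, mul_zero, zero_mul, add_zero, smul_zero]

lemma IsQuantumMatrix.oreDer_anti (hq : q ≠ 0) (hx : IsQuantumMatrix q S x)
    (hS : Precedes S r l) {i i' j j' : ℕ} (h : i < i') (h' : j < j') (h1 : S i j')
    (h2 : S i' j) :
    oreTwist q x r l i j' * oreDer q x r l i' j + oreDer q x r l i j' * x i' j =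
      oreTwist q x r l i' j * oreDer q x r l i j' + oreDer q x r l i' j * x i j' := by
  rcases hS.lex h2 with hi' | ⟨rfl, hj⟩
  · have hi := h.trans hi'
    have h4 := hS.right h1 hi
    have h5 := hS.right h2 hi'
    rcases lt_trichotomy j' l with hl | rfl | hl
    · have hj := h'.trans hl
      have h3 := hS.left h1 hl
      have h6 := hS.left h2 hj
      have h7 := hS.cross h2 h1 hi'
      simp only [h, h', h1, h2, h3, h4, h5, h6, h7, hi, hi', hj, hl, oreTwist_left,
        oreTwist_right, oreTwist_same_col,
        oreTwist_same_row, oreDer_left, oreDer_right, oreDer_same_col, oreDer_same_row,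
        mul_zero, zero_mul, add_zero, zero_add, smul_zero, mul_assoc, smul_mul_assoc, mul_smul_comm,
        hx.row, hx.col, hx.anti_smul, hx.diag,
        hx.row_assoc, hx.col_assoc, hx.anti_assoc, hx.diag_assoc,
        add_mul, mul_add, smul_add, smul_smul]
      match_scalars <;> field_simp
    · have h6 := hS.left h2 h'
      simp only [h, h', h1, h2, h4, h5, h6, hi, hi', oreTwist_left,
        oreTwist_right, oreTwist_same_col,
        oreTwist_same_row, oreDer_left, oreDer_right, oreDer_same_col, oreDer_same_row,
        mul_zero, zero_mul, add_zero, zero_add, smul_zero, mul_assoc, smul_mul_assoc, mul_smul_comm,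
        hx.row, hx.col, hx.anti_smul, hx.diag,
        hx.row_assoc, hx.col_assoc, hx.anti_assoc, hx.diag_assoc,
        add_mul, mul_add, smul_add, smul_smul]
      match_scalars <;> field_simp
    · rcases lt_trichotomy j l with hj | rfl | hj
      · have h6 := hS.left h2 hj
        simp only [h, h', h1, h2, h4, h5, h6, hi, hi', hj, hl, oreTwist_left,
        oreTwist_right, oreTwist_same_col,
          oreTwist_same_row, oreDer_left, oreDer_right, oreDer_same_col, oreDer_same_row,
          mul_zero, zero_mul, add_zero, zero_add, smul_zero, mul_assoc, smul_mul_assoc, mul_smul_comm,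
          hx.row, hx.col, hx.anti_smul, hx.diag,
          hx.row_assoc, hx.col_assoc, hx.anti_assoc, hx.diag_assoc,
          add_mul, mul_add, smul_add, smul_smul]
        match_scalars <;> field_simp
      · simp only [oreDer_same_col, oreDer_right hl, mul_zero, zero_mul, add_zero, smul_zero]
      · simp only [oreDer_right hj, oreDer_right hl, mul_zero, zero_mul, add_zero, smul_zero]
  · have h4 := hS.right h1 h
    rcases lt_trichotomy j' l with hl | rfl | hl
    · have h3 := hS.left h1 hl
      simp only [h, h', h1, h2, h3, h4, hj, hl, oreTwist_left,
        oreTwist_right, oreTwist_same_col,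
        oreTwist_same_row, oreDer_left, oreDer_right, oreDer_same_col, oreDer_same_row,
        mul_zero, zero_mul, add_zero, zero_add, smul_zero, mul_assoc, smul_mul_assoc, mul_smul_comm,
        hx.row, hx.col, hx.anti_smul, hx.diag,
        hx.row_assoc, hx.col_assoc, hx.anti_assoc, hx.diag_assoc,
        add_mul, mul_add, smul_add, smul_smul]
      match_scalars <;> field_simp
    · simp only [oreDer_same_col, oreDer_same_row, mul_zero, zero_mul, add_zero, smul_zero]
    · simp only [oreDer_right hl, oreDer_same_row, mul_zero, zero_mul, add_zero, smul_zero]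

lemma IsQuantumMatrix.oreDer_diag (hq : q ≠ 0) (hx : IsQuantumMatrix q S x)
    (hS : Precedes S r l) {i i' j j' : ℕ} (h : i < i') (h' : j < j') (h1 : S i j) (h2 : S i j')
    (h3 : S i' j) (h4 : S i' j') :
    oreTwist q x r l i j * oreDer q x r l i' j' + oreDer q x r l i j * x i' j' =
      oreTwist q x r l i' j' * oreDer q x r l i j + oreDer q x r l i' j' * x i j +
        (q - q⁻¹) • (oreTwist q x r l i' j * oreDer q x r l i j' +
          oreDer q x r l i' j * x i j') := by
  rcases hS.lex h4 with hi' | ⟨rfl, hl⟩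
  · have hi := h.trans hi'
    have h5 := hS.right h1 hi
    have h6 := hS.right h3 hi'
    rcases lt_trichotomy j' l with hl | rfl | hl
    · have hj := h'.trans hl
      have h7 := hS.left h3 hj
      have h8 := hS.left h4 hl
      simp only [h, h', h1, h2, h3, h4, h5, h6, h7, h8, hi, hi', hj, hl, oreTwist_left,
        oreTwist_right, oreTwist_same_col,
        oreTwist_same_row, oreDer_left, oreDer_right, oreDer_same_col, oreDer_same_row,
        mul_zero, zero_mul, add_zero, zero_add, smul_zero, mul_assoc, smul_mul_assoc, mul_smul_comm,
        hx.row, hx.col, hx.anti_smul, hx.diag,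
        hx.row_assoc, hx.col_assoc, hx.anti_assoc, hx.diag_assoc,
        add_mul, mul_add, smul_add, smul_smul]
      match_scalars <;> field_simp <;> ring
    · have h7 := hS.left h3 h'
      simp only [h, h', h1, h2, h3, h4, h5, h6, h7, hi, hi', oreTwist_left,
        oreTwist_right, oreTwist_same_col,
        oreTwist_same_row, oreDer_left, oreDer_right, oreDer_same_col, oreDer_same_row,
        mul_zero, zero_mul, add_zero, zero_add, smul_zero, mul_assoc, smul_mul_assoc, mul_smul_comm,
        hx.row, hx.col, hx.anti_smul, hx.diag,
        hx.row_assoc, hx.col_assoc, hx.anti_assoc, hx.diag_assoc,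
        add_mul, mul_add, smul_add, smul_smul]
      match_scalars <;> field_simp <;> ring
    · rcases lt_trichotomy j l with hj | rfl | hj
      · have h7 := hS.left h3 hj
        simp only [h, h', h1, h2, h3, h4, h5, h6, h7, hi, hi', hj, hl, oreTwist_left,
        oreTwist_right, oreTwist_same_col,
          oreTwist_same_row, oreDer_left, oreDer_right, oreDer_same_col, oreDer_same_row,
          mul_zero, zero_mul, add_zero, zero_add, smul_zero, mul_assoc, smul_mul_assoc, mul_smul_comm,
          hx.row, hx.col, hx.anti_smul, hx.diag,
          hx.row_assoc, hx.col_assoc, hx.anti_assoc, hx.diag_assoc,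
          add_mul, mul_add, smul_add, smul_smul]
        match_scalars <;> field_simp
      · simp only [oreDer_same_col, oreDer_right hl, mul_zero, zero_mul, add_zero, smul_zero]
      · simp only [oreDer_right hj, oreDer_right hl, mul_zero, zero_mul, add_zero, smul_zero]
  · have hj := h'.trans hl
    have h5 := hS.right h1 h
    simp only [h, h', h1, h2, h3, h4, h5, hj, hl, oreTwist_left,
        oreTwist_right, oreTwist_same_col,
      oreTwist_same_row, oreDer_left, oreDer_right, oreDer_same_col, oreDer_same_row,
      mul_zero, zero_mul, add_zero, zero_add, smul_zero, mul_assoc, smul_mul_assoc, mul_smul_comm,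
      hx.row, hx.col, hx.anti_smul, hx.diag,
      hx.row_assoc, hx.col_assoc, hx.anti_assoc, hx.diag_assoc,
      add_mul, mul_add, smul_add, smul_smul]
    match_scalars <;> field_simp <;> ring

/-- Multiplying matrices with rows `(σ a, δ a)` and `(0, a)` gives the corner `σ a * δ b + δ a * b`.
So the relations for these matrices state together that the twist respects the relations and that
the derivation does. -/
lemma IsQuantumMatrix.oreMatrix (hq : q ≠ 0) (hx : IsQuantumMatrix q S x)
    (hS : Precedes S r l) : IsQuantumMatrix q S (oreMatrix q x r l) where
  row {i j j'} h h1 h2 := by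
    simp [_root_.oreMatrix, Matrix.mul_fin_two, hx.row h h1 h2, hx.oreTwist_row h h1 h2,
      hx.oreDer_row hq hS h h1 h2]
  col {i i' j} h h1 h2 := by
    simp [_root_.oreMatrix, Matrix.mul_fin_two, hx.col h h1 h2, hx.oreTwist_col h h1 h2,
      hx.oreDer_col hq hS h h1 h2]
  anti {i i' j j'} h h' h1 h2 := by
    simp [_root_.oreMatrix, Matrix.mul_fin_two, hx.anti h h' h1 h2, hx.oreTwist_anti h h' h1 h2,
      hx.oreDer_anti hq hS h h' h1 h2]
  diag {i i' j j'} h h' h1 h2 h3 h4 := by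
    simp [_root_.oreMatrix, Matrix.mul_fin_two, hx.diag h h' h1 h2 h3 h4,
      hx.oreTwist_diag hS h h' h1 h2 h3 h4, hx.oreDer_diag hq hS h h' h1 h2 h3 h4]

end OreStep

/-! ### Iterated Ore extensions and independence of ordered monomials -/

section Stage

variable {k : Type*} [Field k]

/-- The relations of quantum matrices among the positions in `S`; the other generators are
free. -/
inductive StageRel (q : k) (S : ℕ → ℕ → Prop) :
    FreeAlgebra k (ℕ × ℕ) → FreeAlgebra k (ℕ × ℕ) → Prop
  | row {i j l : ℕ} : j < l → S i j → S i l → StageRel q S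
      (FreeAlgebra.ι k (i, j) * FreeAlgebra.ι k (i, l))
      (q • (FreeAlgebra.ι k (i, l) * FreeAlgebra.ι k (i, j)))
  | col {i r j : ℕ} : i < r → S i j → S r j → StageRel q S
      (FreeAlgebra.ι k (i, j) * FreeAlgebra.ι k (r, j))
      (q • (FreeAlgebra.ι k (r, j) * FreeAlgebra.ι k (i, j)))
  | anti {i r j l : ℕ} : i < r → j < l → S i l → S r j → StageRel q S
      (FreeAlgebra.ι k (i, l) * FreeAlgebra.ι k (r, j))
      (FreeAlgebra.ι k (r, j) * FreeAlgebra.ι k (i, l))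
  | diag {i r j l : ℕ} : i < r → j < l → S i j → S i l → S r j → S r l → StageRel q S
      (FreeAlgebra.ι k (i, j) * FreeAlgebra.ι k (r, l))
      (FreeAlgebra.ι k (r, l) * FreeAlgebra.ι k (i, j) +
        (q - q⁻¹) • (FreeAlgebra.ι k (r, j) * FreeAlgebra.ι k (i, l)))

/-- The algebra presented by the relations among the positions in `S`. -/
def StageAlg (q : k) (S : ℕ → ℕ → Prop) : Type _ := RingQuot (StageRel q S)

noncomputable instance (q : k) (S : ℕ → ℕ → Prop) : Ring (StageAlg q S) :=
  inferInstanceAs (Ring (RingQuot (StageRel q S)))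

noncomputable instance (q : k) (S : ℕ → ℕ → Prop) : Algebra k (StageAlg q S) :=
  inferInstanceAs (Algebra k (RingQuot (StageRel q S)))

/-- The quotient map onto `StageAlg`. -/
noncomputable def StageAlg.mk (q : k) (S : ℕ → ℕ → Prop) :
    FreeAlgebra k (ℕ × ℕ) →ₐ[k] StageAlg q S :=
  RingQuot.mkAlgHom k (StageRel q S)

lemma StageAlg.mk_surjective (q : k) (S : ℕ → ℕ → Prop) :
    Function.Surjective (StageAlg.mk q S) :=
  RingQuot.mkAlgHom_surjective k (StageRel q S)

lemma StageAlg.mk_rel {q : k} {S : ℕ → ℕ → Prop} {a b : FreeAlgebra k (ℕ × ℕ)}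
    (h : StageRel q S a b) : StageAlg.mk q S a = StageAlg.mk q S b :=
  RingQuot.mkAlgHom_rel k h

/-- The generators of `StageAlg`. -/
noncomputable def StageAlg.X (q : k) (S : ℕ → ℕ → Prop) (i j : ℕ) : StageAlg q S :=
  StageAlg.mk q S (FreeAlgebra.ι k (i, j))

lemma StageAlg.isQuantumMatrix (q : k) (S : ℕ → ℕ → Prop) :
    IsQuantumMatrix q S (StageAlg.X q S) where
  row h h1 h2 := by
    simpa [StageAlg.X] using StageAlg.mk_rel (StageRel.row (q := q) h h1 h2)
  col h h1 h2 := by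
    simpa [StageAlg.X] using StageAlg.mk_rel (StageRel.col (q := q) h h1 h2)
  anti h h' h1 h2 := by
    simpa [StageAlg.X] using StageAlg.mk_rel (StageRel.anti (q := q) h h' h1 h2)
  diag h h' h1 h2 h3 h4 := by
    simpa [StageAlg.X] using StageAlg.mk_rel (StageRel.diag (q := q) h h' h1 h2 h3 h4)

variable {q : k} {S : ℕ → ℕ → Prop} {A : Type*} [Ring A] [Algebra k A]

lemma StageAlg.exists_lift {x : ℕ → ℕ → A} (hx : IsQuantumMatrix q S x) :
    ∃ φ : StageAlg q S →ₐ[k] A, ∀ i j, φ (StageAlg.X q S i j) = x i j := by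
  have hrel : ∀ ⦃a b⦄, StageRel q S a b → FreeAlgebra.lift k (fun p : ℕ × ℕ => x p.1 p.2) a =
      FreeAlgebra.lift k (fun p : ℕ × ℕ => x p.1 p.2) b := by
    rintro a b (⟨h, h1, h2⟩ | ⟨h, h1, h2⟩ | ⟨h, h', h1, h2⟩ | ⟨h, h', h1, h2, h3, h4⟩)
    · simpa using hx.row h h1 h2
    · simpa using hx.col h h1 h2
    · simpa using hx.anti h h' h1 h2
    · simpa using hx.diag h h' h1 h2 h3 h4
  refine ⟨RingQuot.liftAlgHom k ⟨FreeAlgebra.lift k fun p => x p.1 p.2, hrel⟩, fun i j => ?_⟩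
  exact (RingQuot.liftAlgHom_mkAlgHom_apply _ _ hrel _).trans (FreeAlgebra.lift_ι_apply _ _)

lemma StageAlg.induction {P : StageAlg q S → Prop} (halg : ∀ c : k, P (algebraMap k _ c))
    (hX : ∀ i j, P (StageAlg.X q S i j)) (hmul : ∀ a b, P a → P b → P (a * b))
    (hadd : ∀ a b, P a → P b → P (a + b)) (a : StageAlg q S) : P a := by
  obtain ⟨a, rfl⟩ := mk_surjective q S a
  induction a using FreeAlgebra.induction with
  | grade0 c => rw [AlgHom.commutes]; exact halg c
  | grade1 p => exact hX p.1 p.2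
  | mul a b ha hb => rw [map_mul]; exact hmul _ _ ha hb
  | add a b ha hb => rw [map_add]; exact hadd _ _ ha hb

/-- The skew derivation attached to the next generator, with its twisting endomorphism. -/
lemma StageAlg.exists_skewDerivation (hq : q ≠ 0) {r l : ℕ} (hS : Precedes S r l) :
    ∃ σ δ : StageAlg q S →ₗ[k] StageAlg q S, σ 1 = 1 ∧ δ 1 = 0 ∧
      (∀ a b, σ (a * b) = σ a * σ b) ∧ (∀ a b, δ (a * b) = σ a * δ b + δ a * b) ∧
      (∀ i j, σ (X q S i j) = oreTwist q (X q S) r l i j) ∧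
      (∀ i j, δ (X q S i j) = oreDer q (X q S) r l i j) := by
  obtain ⟨φ, hφ⟩ := exists_lift ((isQuantumMatrix q S).oreMatrix hq hS)
  -- The lower row of `φ a` is `(0, a)`, so multiplicativity of `φ` read in the upper row is
  -- multiplicativity of `σ` and the twisted Leibniz rule for `δ`.
  have h10 : ∀ a, φ a 1 0 = 0 ∧ φ a 1 1 = a := by
    intro a
    induction a using StageAlg.induction with
    | halg c => simp [Matrix.algebraMap_matrix_apply]
    | hX i j => simp [hφ, oreMatrix]
    | hmul a b ha hb => simp [Matrix.mul_apply, ha, hb]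
    | hadd a b ha hb => simp [ha, hb]
  let entry (a b : Fin 2) : Matrix (Fin 2) (Fin 2) (StageAlg q S) →ₗ[k] StageAlg q S :=
    Matrix.entryLinearMap k _ a b
  refine ⟨entry 0 0 ∘ₗ φ.toLinearMap, entry 0 1 ∘ₗ φ.toLinearMap, ?_, ?_, ?_, ?_, ?_, ?_⟩
  · simp [entry]
  · simp [entry]
  · intro a b; simp [entry, Matrix.mul_apply, h10]
  · intro a b; simp [entry, Matrix.mul_apply, h10]
  · intro i j; simp [entry, hφ, oreMatrix]
  · intro i j; simp [entry, hφ, oreMatrix]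

/-- The operator by which the next generator acts on polynomials over `StageAlg`. -/
noncomputable def oreOperator {R : Type*} [Ring R] [Algebra k R] (σ δ : R →ₗ[k] R) :
    (ℕ →₀ R) →ₗ[k] (ℕ →₀ R) :=
  Finsupp.lmapDomain R k Nat.succ ∘ₗ Finsupp.mapRange.linearMap σ + Finsupp.mapRange.linearMap δ

lemma oreOperator_single {R : Type*} [Ring R] [Algebra k R] (σ δ : R →ₗ[k] R) (i : ℕ) (a : R) :
    oreOperator σ δ (Finsupp.single i a) =
      Finsupp.single (i + 1) (σ a) + Finsupp.single i (δ a) := by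
  simp [oreOperator]

/-- The Ore rule `t a = σ(a) t + δ(a)`, as an identity of operators on polynomials in `t` with
coefficients on the left. -/
lemma oreOperator_mul_lsmul {R : Type*} [Ring R] [Algebra k R] (σ δ : R →ₗ[k] R)
    (hσ : ∀ a b, σ (a * b) = σ a * σ b) (hδ : ∀ a b, δ (a * b) = σ a * δ b + δ a * b) (a : R) :
    oreOperator σ δ * Algebra.lsmul k k (ℕ →₀ R) a =
      Algebra.lsmul k k (ℕ →₀ R) (σ a) * oreOperator σ δ +
        Algebra.lsmul k k (ℕ →₀ R) (δ a) := by
  ext i b : 2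
  simp only [LinearMap.comp_apply, Finsupp.lsingle_apply, Module.End.mul_apply,
    LinearMap.add_apply, Algebra.lsmul_coe, Finsupp.smul_single, smul_eq_mul, oreOperator_single,
    hσ, hδ, Finsupp.single_add, smul_add, add_assoc]

/-- Instead of building the Ore extension as a ring, the enlarged algebra acts on what would be its
underlying module: old generators by left multiplication, the new one as `t`. As `(r, l)` is
lexicographically last, it can only be the later factor of a relation, and each such relation is a
case of the Ore rule. -/
lemma StageAlg.exists_oreRepresentation (hq : q ≠ 0) {r l : ℕ} (hS : Precedes S r l)
    {S' : ℕ → ℕ → Prop} (hS' : ∀ i j, S' i j ↔ S i j ∨ i = r ∧ j = l) :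
    ∃ (φ : StageAlg q S' →ₐ[k] Module.End k (ℕ →₀ StageAlg q S)),
      (∀ i j, S i j → φ (X q S' i j) = Algebra.lsmul k k _ (X q S i j)) ∧
      ∀ i, φ (X q S' r l) (Finsupp.single i 1) = Finsupp.single (i + 1) 1 := by
  obtain ⟨σ, δ, hσ1, hδ1, hσ, hδ, hσX, hδX⟩ := exists_skewDerivation hq hS
  have hx := isQuantumMatrix q S
  set L := Algebra.lsmul k k (A := StageAlg q S) (ℕ →₀ StageAlg q S) with hL
  set T := oreOperator σ δ with hT
  have hTL : ∀ i j, T * L (X q S i j) = L (oreTwist q (X q S) r l i j) * T +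
      L (oreDer q (X q S) r l i j) := fun i j => by
    rw [← hσX, ← hδX]; exact oreOperator_mul_lsmul σ δ hσ hδ _
  have hnot : ¬ S r l := fun h => by have := hS.lex h; omega
  let W : ℕ → ℕ → Module.End k (ℕ →₀ StageAlg q S) := fun i j =>
    if i = r ∧ j = l then T else L (X q S i j)
  have hWS : ∀ {i j}, S i j → W i j = L (X q S i j) := fun {i j} h =>
    if_neg (by rintro ⟨rfl, rfl⟩; exact hnot h)
  have hWT : W r l = T := if_pos ⟨rfl, rfl⟩
  have hW : IsQuantumMatrix q S' W := by
    constructor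
    · intro i j j' h h1 h2
      rw [hS'] at h1 h2
      rcases h1 with h1 | ⟨rfl, rfl⟩ <;> rcases h2 with h2 | ⟨h2, h2'⟩
      · simp only [hWS h1, hWS h2, ← map_mul, ← map_smul, hx.row h h1 h2]
      · subst h2 h2'
        rw [hWS h1, hWT, hTL, oreTwist_same_row, oreDer_same_row]
        simp [hq]
      · have := hS.lex h2; omega
      · omega
    · intro i i' j h h1 h2
      rw [hS'] at h1 h2
      rcases h1 with h1 | ⟨rfl, rfl⟩ <;> rcases h2 with h2 | ⟨h2, h2'⟩
      · simp only [hWS h1, hWS h2, ← map_mul, ← map_smul, hx.col h h1 h2]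
      · subst h2 h2'
        rw [hWS h1, hWT, hTL, oreTwist_same_col, oreDer_same_col]
        simp [hq]
      · have := hS.lex h2; omega
      · omega
    · intro i i' j j' h h' h1 h2
      rw [hS'] at h1 h2
      rcases h1 with h1 | ⟨rfl, rfl⟩ <;> rcases h2 with h2 | ⟨h2, h2'⟩
      · simp only [hWS h1, hWS h2, ← map_mul, hx.anti h h' h1 h2]
      · subst h2 h2'
        rw [hWS h1, hWT, hTL, oreTwist_right h h', oreDer_right h']
        simp
      · have := hS.lex h2; omega
      · omega
    · intro i i' j j' h h' h1 h2 h3 h4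
      rw [hS'] at h1 h2 h3 h4
      have key : ∀ {a b}, S a b ∨ a = r ∧ b = l → a < r ∨ a = r ∧ b ≤ l := fun {a b} h => by
        rcases h with h | h
        · have := hS.lex h; omega
        · omega
      have k4 := key h4
      have h1' : S i j := h1.resolve_right (by omega)
      have h2' : S i j' := h2.resolve_right (by omega)
      have h3' : S i' j := h3.resolve_right (by omega)
      rcases h4 with h4 | ⟨rfl, rfl⟩
      · simp only [hWS h1', hWS h2', hWS h3', hWS h4, ← map_mul, ← map_smul, ← map_add,
          hx.diag h h' h1' h2' h3' h4]
      · rw [hWS h1', hWS h2', hWS h3', hWT, hTL, oreTwist_left h h', oreDer_left h h',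
          map_smul, map_mul]
        module
  obtain ⟨φ, hφ⟩ := exists_lift hW
  refine ⟨φ, fun i j h => by rw [hφ, hWS h], fun i => ?_⟩
  rw [hφ, hWT, hT, oreOperator_single, hσ1, hδ1, Finsupp.single_zero, add_zero]

/-- Adjoining the next generator preserves linear independence of ordered monomials. -/
lemma StageAlg.linearIndependent_snoc (hq : q ≠ 0) {c : ℕ} {pos : ℕ → ℕ × ℕ}
    (hS : Precedes S (pos c).1 (pos c).2) (hpos : ∀ d < c, S (pos d).1 (pos d).2)
    {S' : ℕ → ℕ → Prop} (hS' : ∀ i j, S' i j ↔ S i j ∨ i = (pos c).1 ∧ j = (pos c).2)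
    (h : LinearIndependent k fun a : Fin c → ℕ =>
      (List.ofFn fun i : Fin c => X q S (pos i).1 (pos i).2 ^ a i).prod) :
    LinearIndependent k fun a : Fin (c + 1) → ℕ =>
      (List.ofFn fun i : Fin (c + 1) => X q S' (pos i).1 (pos i).2 ^ a i).prod := by
  obtain ⟨φ, hφ, hφt⟩ := exists_oreRepresentation hq hS hS'
  let ev : StageAlg q S' →ₗ[k] (ℕ →₀ StageAlg q S) :=
    LinearMap.applyₗ (Finsupp.single 0 1) ∘ₗ φ.toLinearMap
  apply LinearIndependent.of_comp ev
  have hpow : ∀ i, (φ (X q S' (pos c).1 (pos c).2) ^ i) (Finsupp.single 0 1) =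
      Finsupp.single i 1 := by
    intro i
    induction i with
    | zero => simp
    | succ i ih => rw [pow_succ', Module.End.mul_apply, ih, hφt]
  -- The new generator stands rightmost, so applying a monomial to `1` first produces a power of `t`
  -- and then puts the old monomial in front as its coefficient. Different powers of `t` are
  -- independent.
  have hev : ∀ a : Fin (c + 1) → ℕ,
      ev (List.ofFn fun i : Fin (c + 1) => X q S' (pos i).1 (pos i).2 ^ a i).prod =
      Finsupp.single (a (Fin.last c))
        (List.ofFn fun i : Fin c => X q S (pos i).1 (pos i).2 ^ a i.castSucc).prod := by
    intro a
    have h1 : φ (List.ofFn fun i : Fin c => X q S' (pos i).1 (pos i).2 ^ a i.castSucc).prod =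
        Algebra.lsmul k k _
          (List.ofFn fun i : Fin c => X q S (pos i).1 (pos i).2 ^ a i.castSucc).prod := by
      rw [map_list_prod, map_list_prod, List.map_ofFn, List.map_ofFn]
      congr 2
      funext i
      simp [hφ _ _ (hpos i i.2)]
    simp only [ev, LinearMap.comp_apply, AlgHom.toLinearMap_apply, LinearMap.applyₗ_apply_apply]
    rw [List.ofFn_succ', List.concat_eq_append, List.prod_append, map_mul]
    simp only [Fin.val_castSucc, h1, Fin.val_last, List.prod_singleton, map_pow,
      Module.End.mul_apply, hpow]
    simp
  have h2 := Finsupp.linearIndependent_single (ι := ℕ) (R := k) _ (fun _ => h)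
  have h3 := h2.comp (fun a : Fin (c + 1) → ℕ =>
    (⟨a (Fin.last c), fun i => a i.castSucc⟩ : Σ _ : ℕ, (Fin c → ℕ))) (by
      intro a b hab
      simp only [Sigma.mk.injEq, heq_eq_eq] at hab
      funext i
      refine Fin.lastCases hab.1 (fun i => congrFun hab.2 i) i)
  convert h3 using 1
  funext a
  exact hev a

lemma mul_add_lt_iff_lex {n i j r l : ℕ} (hj : j < n) (hl : l < n) :
    i * n + j < r * n + l ↔ i < r ∨ i = r ∧ j < l := by
  rcases lt_trichotomy i r with h | rfl | h
  · have : (i + 1) * n ≤ r * n := Nat.mul_le_mul_right n h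
    have : (i + 1) * n = i * n + n := by ring
    omega
  · omega
  · have : (r + 1) * n ≤ i * n := Nat.mul_le_mul_right n h
    have : (r + 1) * n = r * n + n := by ring
    omega

/-- The first `c` positions of a matrix with `n` columns, read row by row. -/
def initialPositions (n c i j : ℕ) : Prop := j < n ∧ i * n + j < c

theorem StageAlg.linearIndependent_monomials (hq : q ≠ 0) {n : ℕ} (hn : 0 < n) (c : ℕ) :
    LinearIndependent k fun a : Fin c → ℕ =>
      (List.ofFn fun i : Fin c =>
        X q (initialPositions n c) (i / n : ℕ) (i % n : ℕ) ^ a i).prod := by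
  induction c with
  | zero =>
    -- With no positions there are no relations; sending all generators to `0` in `k` shows that the
    -- algebra is nontrivial, so the empty monomial is nonzero.
    obtain ⟨φ, -⟩ := exists_lift (q := q) (S := initialPositions n 0)
      (x := fun _ _ => (0 : k))
      ⟨by simp, by simp, by simp, by simp⟩
    have : Nontrivial (StageAlg q (initialPositions n 0)) := φ.toRingHom.domain_nontrivial
    rw [linearIndependent_unique_iff]
    simp
  | succ c ih =>
    have hc : c / n * n + c % n = c := Nat.div_add_mod' c n
    have hl : c % n < n := Nat.mod_lt _ hn
    have hlex : ∀ {i j}, initialPositions n c i j ↔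
        j < n ∧ (i < c / n ∨ i = c / n ∧ j < c % n) := fun {i j} => by
      unfold initialPositions
      constructor
      · rintro ⟨h, h'⟩
        exact ⟨h, (mul_add_lt_iff_lex h hl).1 (by omega)⟩
      · rintro ⟨h, h'⟩
        exact ⟨h, by have := (mul_add_lt_iff_lex h hl).2 h'; omega⟩
    refine linearIndependent_snoc hq (pos := fun d => (d / n, d % n)) (S := initialPositions n c)
      ?_ ?_ ?_ ih
    · constructor
      · intro i j h; exact (hlex.1 h).2
      · intro i j h h'; exact hlex.2 ⟨hl, .inl h'⟩
      · intro i j h h'; exact hlex.2 ⟨(hlex.1 h).1, .inr ⟨rfl, h'⟩⟩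
      · intro i j i' j' h h' h''; exact hlex.2 ⟨(hlex.1 h').1, .inl h''⟩
    · intro d hd
      exact ⟨Nat.mod_lt _ hn, by rw [Nat.div_add_mod']; exact hd⟩
    · intro i j
      rw [hlex]
      have := @mul_add_lt_iff_lex n i j (c / n) (c % n)
      have := @mul_add_lt_iff_lex n (c / n) (c % n) i j
      unfold initialPositions
      omega

end Stage

/-! ### Quantum matrices form a domain -/

section QMatDomain

variable {k : Type*} [Field k] (q : k) (m n : ℕ)

/-- The quotient map onto `QMat`. -/
noncomputable def QMat.mk : FreeAlgebra k (Fin m × Fin n) →ₐ[k] QMat q m n :=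
  RingQuot.mkAlgHom k (QMatRel q m n)

variable {m n} in
lemma QMat.mk_rel {a b : FreeAlgebra k (Fin m × Fin n)} (h : QMatRel q m n a b) :
    QMat.mk q m n a = QMat.mk q m n b :=
  RingQuot.mkAlgHom_rel k h

lemma QMat.isQuantumMatrix :
    IsQuantumMatrix q (fun _ _ => True) (QMat.X q (m := m) (n := n)) where
  row {i j l} h _ _ := by
    have := QMat.mk_rel q (QMatRel.row i j l h)
    rwa [map_mul, map_smul, map_mul] at this
  col {i r j} h _ _ := by
    have := QMat.mk_rel q (QMatRel.col i r j h)
    rwa [map_mul, map_smul, map_mul] at this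
  anti {i r j l} h h' _ _ := by
    have := QMat.mk_rel q (QMatRel.anti i r j l h h')
    rwa [map_mul, map_mul] at this
  diag {i r j l} h h' _ _ _ _ := by
    have h1 := QMat.mk_rel q (QMatRel.anti _ _ _ _ h h')
    have h2 := QMat.mk_rel q (QMatRel.diag _ _ _ _ h h')
    simp only [map_sub, map_mul, map_smul] at h1 h2
    rw [h1, sub_eq_iff_eq_add'] at h2
    exact h2

variable {q m n} in
lemma QMat.exists_lift {A : Type*} [Ring A] [Algebra k A] {x : Fin m → Fin n → A}
    (hx : IsQuantumMatrix q (fun _ _ => True) x) :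
    ∃ φ : QMat q m n →ₐ[k] A, ∀ i j, φ (QMat.X q i j) = x i j := by
  have hrel : ∀ ⦃a b⦄, QMatRel q m n a b →
      FreeAlgebra.lift k (fun p : Fin m × Fin n => x p.1 p.2) a =
      FreeAlgebra.lift k (fun p : Fin m × Fin n => x p.1 p.2) b := by
    rintro a b (⟨i, j, l, h⟩ | ⟨i, r, j, h⟩ | ⟨i, r, j, l, h, h'⟩ | ⟨i, r, j, l, h, h'⟩)
    · simpa using hx.row h trivial trivial
    · simpa using hx.col h trivial trivial
    · simpa using hx.anti h h' trivial trivial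
    · have h1 := hx.anti h h' trivial trivial
      have h2 := hx.diag h h' trivial trivial trivial trivial
      rw [← h1] at h2
      simpa [sub_eq_iff_eq_add'] using h2
  refine ⟨RingQuot.liftAlgHom k ⟨FreeAlgebra.lift k fun p => x p.1 p.2, hrel⟩, fun i j => ?_⟩
  exact (RingQuot.liftAlgHom_mkAlgHom_apply _ _ hrel _).trans (FreeAlgebra.lift_ι_apply _ _)

lemma QMat.adjoin_range_X :
    Algebra.adjoin k (Set.range fun p : Fin m × Fin n => QMat.X q p.1 p.2) = ⊤ := by
  have hs : Function.Surjective (QMat.mk q m n) := RingQuot.mkAlgHom_surjective k _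
  have h1 : (Set.range fun p : Fin m × Fin n => QMat.X q p.1 p.2) =
      QMat.mk q m n '' Set.range (FreeAlgebra.ι k) := by
    rw [← Set.range_comp]; rfl
  rw [h1, ← AlgHom.map_adjoin, FreeAlgebra.adjoin_range_ι, Algebra.map_top,
    (AlgHom.range_eq_top _).2 hs]

variable {q}

/-- Only the diagonal relation has a correction term, the antidiagonal product. For the weight `i *
j` it is lower by `(r - i) * (l - j) > 0`. -/
lemma QMat.weightedQuasiCommutes (hq : q ≠ 0) :
    WeightedQuasiCommutes k (fun p : Fin m × Fin n => QMat.X q p.1 p.2)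
      (fun p => (p.1 * p.2 : ℕ)) := by
  have hx := QMat.isQuantumMatrix q m n
  have hlt : ∀ {i r j l : ℕ}, i < r → j < l → r * j + i * l < i * j + r * l := by
    intro i r j l h h'
    obtain ⟨a, rfl⟩ := Nat.exists_eq_add_of_lt h
    obtain ⟨b, rfl⟩ := Nat.exists_eq_add_of_lt h'
    nlinarith
  rintro ⟨i, j⟩ ⟨r, l⟩
  rcases lt_trichotomy i r with h | rfl | h <;> rcases lt_trichotomy j l with h' | rfl | h'
  · refine ⟨1, one_ne_zero, ?_⟩
    simp only [hx.diag h h' trivial trivial trivial trivial, one_smul, add_sub_cancel_left]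
    exact Submodule.smul_mem _ _ (Submodule.subset_span ⟨(r, j), (i, l), hlt h h', rfl⟩)
  · exact ⟨q, hq, by simp [hx.col h trivial trivial]⟩
  · exact ⟨1, one_ne_zero, by simp [hx.anti h h' trivial trivial]⟩
  · exact ⟨q, hq, by simp [hx.row h' trivial trivial]⟩
  · exact ⟨1, one_ne_zero, by simp⟩
  · exact ⟨q⁻¹, inv_ne_zero hq, by simp [hx.row h' trivial trivial, hq]⟩
  · exact ⟨1, one_ne_zero, by simp [hx.anti h h' trivial trivial]⟩
  · exact ⟨q⁻¹, inv_ne_zero hq, by simp [hx.col h trivial trivial, hq]⟩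
  · refine ⟨1, one_ne_zero, ?_⟩
    simp only [hx.diag h h' trivial trivial trivial trivial, one_smul, sub_add_cancel_left]
    refine neg_mem (Submodule.smul_mem _ _ (Submodule.subset_span ⟨(i, l), (r, j), ?_, rfl⟩))
    have := hlt h h'
    simp only
    omega

/-- The word with the given content which is increasing for the enumeration `e`. -/
def increasingWord {N : ℕ} {ι : Type*} [DecidableEq ι] (e : Fin N ≃ ι) (s : Multiset ι) :
    List ι :=
  (List.finRange N).flatMap fun i => List.replicate (s.count (e i)) (e i)

lemma coe_increasingWord {N : ℕ} {ι : Type*} [DecidableEq ι] (e : Fin N ≃ ι) (s : Multiset ι) :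
    (increasingWord e s : Multiset ι) = s := by
  ext p
  rw [Multiset.coe_count, increasingWord, List.count_flatMap]
  obtain ⟨i, rfl⟩ := e.surjective p
  simp only [Function.comp_def, List.count_replicate, beq_iff_eq, EmbeddingLike.apply_eq_iff_eq]
  rw [← List.ofFn_eq_map, List.sum_ofFn]
  simp

lemma wordProd_increasingWord {N : ℕ} {ι A : Type*} [DecidableEq ι] [Ring A] (e : Fin N ≃ ι)
    (u : ι → A) (s : Multiset ι) :
    wordProd u (increasingWord e s) =
      (List.ofFn fun i : Fin N => u (e i) ^ s.count (e i)).prod := by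
  rw [List.ofFn_eq_map, increasingWord]
  induction List.finRange N with
  | nil => simp
  | cons i L ih =>
    rw [List.flatMap_cons, wordProd_append, ih, List.map_cons, List.prod_cons]
    simp [wordProd]

/-- Independence is pulled back along the map to the stage algebra with all `m * n` positions; no
inverse of that map is needed. The enumeration `finProdFinEquiv` is the row-by-row reading used
there. -/
theorem QMat.linearIndependent_increasingWord (hq : q ≠ 0) (hn : 0 < n) :
    LinearIndependent k fun s : Multiset (Fin m × Fin n) =>
      wordProd (fun p : Fin m × Fin n => QMat.X q p.1 p.2) (increasingWord finProdFinEquiv.symm s) := by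
  have hS := StageAlg.isQuantumMatrix q (initialPositions n (m * n))
  have hmem : ∀ (i : Fin m) (j : Fin n), initialPositions n (m * n) i j := fun i j =>
    ⟨j.2, by
      have : (i + 1 : ℕ) * n ≤ m * n := Nat.mul_le_mul_right n i.2
      have := j.2
      rw [add_mul] at *
      omega⟩
  obtain ⟨φ, hφ⟩ := QMat.exists_lift (q := q) (m := m) (n := n)
    (x := fun i j => StageAlg.X q (initialPositions n (m * n)) i j)
    ⟨fun h _ _ => hS.row h (hmem _ _) (hmem _ _), fun h _ _ => hS.col h (hmem _ _) (hmem _ _),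
      fun h h' _ _ => hS.anti h h' (hmem _ _) (hmem _ _),
      fun h h' _ _ _ _ => hS.diag h h' (hmem _ _) (hmem _ _) (hmem _ _) (hmem _ _)⟩
  apply LinearIndependent.of_comp φ.toLinearMap
  have h := (StageAlg.linearIndependent_monomials hq hn (m * n)).comp
    (fun (s : Multiset (Fin m × Fin n)) (i : Fin (m * n)) => s.count (finProdFinEquiv.symm i)) (by
      intro s t hst
      ext p
      obtain ⟨i, rfl⟩ := finProdFinEquiv.symm.surjective p
      exact congrFun hst i)
  refine (linearIndependent_equiv' (Equiv.refl _) (funext fun s => ?_)).1 h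
  symm
  simp only [Equiv.coe_refl, id_eq, Function.comp_apply, AlgHom.toLinearMap_apply, wordProd_increasingWord,
    map_list_prod, List.map_ofFn]
  congr 2
  funext i
  simp [hφ, Fin.divNat, Fin.modNat]

theorem QMat.isDomain (hq : q ≠ 0) (hn : 0 < n) : IsDomain (QMat q m n) := by
  have hli := QMat.linearIndependent_increasingWord m n hq hn
  have : NoZeroDivisors (QMat q m n) :=
    (QMat.weightedQuasiCommutes m n hq).noZeroDivisors (QMat.adjoin_range_X q m n)
      (coe_increasingWord finProdFinEquiv.symm) hli
  have : Nontrivial (QMat q m n) := ⟨⟨_, 0, hli.ne_zero 0⟩⟩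
  exact NoZeroDivisors.to_isDomain _

end QMatDomain

/-! ### A pair of braided quantum exterior algebras -/

section Exterior

variable {k : Type*} [Field k]
set_option linter.unnecessarySeqFocus false

/-- The relations of the quantum exterior algebra. -/
structure IsQuantumExterior (q : k) {α E : Type*} [LT α] [Ring E] [Algebra k E]
    (e : α → E) : Prop where
  sq : ∀ j, e j * e j = 0
  anti : ∀ {j l}, j < l → e l * e j = (-q) • (e j * e l)

/-- Two families generating quantum exterior algebras, with braiding relations between them. -/
structure IsBraidedPair (q : k) {α E : Type*} [LT α] [Ring E] [Algebra k E]
    (e f : α → E) : Prop where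
  left : IsQuantumExterior q e
  right : IsQuantumExterior q f
  same : ∀ j, e j * f j = q • (f j * e j)
  up : ∀ {j l}, j < l → e j * f l = f l * e j + (q - q⁻¹) • (f j * e l)
  down : ∀ {j l}, j < l → e l * f j = f j * e l

section Construction

variable {E : Type*} [Ring E] [Algebra k E]

/-- Multiplication by the new letter `e`, on the basis `1, f, e, ef`. -/
def newLeft (E : Type*) [Ring E] : Matrix (Fin 4) (Fin 4) E :=
  !![0, 0, 0, 0; 0, 0, 0, 0; 1, 0, 0, 0; 0, 1, 0, 0]

/-- Multiplication by the new letter `f`, on the basis `1, f, e, ef`. -/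
def newRight (q : k) (E : Type*) [Ring E] [Algebra k E] : Matrix (Fin 4) (Fin 4) E :=
  !![0, 0, 0, 0; 1, 0, 0, 0; 0, 0, 0, 0; 0, 0, q⁻¹ • 1, 0]

/-- Multiplication by an old letter `x` of the first family. -/
def oldLeft (q : k) (x : E) : Matrix (Fin 4) (Fin 4) E :=
  !![x, 0, 0, 0; 0, x, 0, 0; 0, 0, (-q) • x, 0; 0, 0, 0, (-q) • x]

/-- Multiplication by an old letter `y` of the second family, with partner `x`. -/
def oldRight (q : k) (x y : E) : Matrix (Fin 4) (Fin 4) E :=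
  !![y, 0, 0, 0; 0, (-q) • y, -(q - q⁻¹) • x, 0; 0, 0, y, 0; 0, 0, 0, (-q) • y]

/-- The first family with a new letter put in front. -/
def extendLeft (q : k) {n : ℕ} (e : Fin n → E) : Fin (n + 1) → Matrix (Fin 4) (Fin 4) E :=
  Fin.cons (newLeft E) fun j => oldLeft q (e j)

/-- The second family with a new letter put in front. -/
def extendRight (q : k) {n : ℕ} (e f : Fin n → E) : Fin (n + 1) → Matrix (Fin 4) (Fin 4) E :=
  Fin.cons (newRight q E) fun j => oldRight q (e j) (f j)

variable {q : k} {n : ℕ} {e f : Fin n → E}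

@[simp] lemma extendLeft_zero : extendLeft q e 0 = newLeft E := rfl

@[simp] lemma extendLeft_succ (j : Fin n) : extendLeft q e j.succ = oldLeft q (e j) := rfl

@[simp] lemma extendRight_zero : extendRight q e f 0 = newRight q E := rfl

@[simp] lemma extendRight_succ (j : Fin n) :
    extendRight q e f j.succ = oldRight q (e j) (f j) := rfl

lemma IsBraidedPair.extendLeft_sq (h : IsBraidedPair q e f) (j : Fin (n + 1)) :
    extendLeft q e j * extendLeft q e j = 0 := by
  refine Fin.cases ?_ (fun j => ?_) j
  · ext a b; fin_cases a <;> fin_cases b <;> simp [Matrix.mul_apply, Fin.sum_univ_four, newLeft]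
  · have h1 := h.left.sq j
    ext a b; fin_cases a <;> fin_cases b <;>
      simp [Matrix.mul_apply, Fin.sum_univ_four, oldLeft, h1]

lemma IsBraidedPair.extendLeft_anti (h : IsBraidedPair q e f) {j l : Fin (n + 1)} : j < l →
    extendLeft q e l * extendLeft q e j =
      (-q) • (extendLeft q e j * extendLeft q e l) := by
  refine Fin.cases ?_ (fun j => ?_) j <;> refine Fin.cases ?_ (fun l => ?_) l
  · simp
  · intro _
    ext a b; fin_cases a <;> fin_cases b <;>
      simp [Matrix.mul_apply, Fin.sum_univ_four, newLeft, oldLeft]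
  · simp
  · intro hjl
    have h1 := h.left.anti (Fin.succ_lt_succ_iff.1 hjl)
    ext a b; fin_cases a <;> fin_cases b <;>
      simp [Matrix.mul_apply, Fin.sum_univ_four, oldLeft, h1]

lemma IsBraidedPair.extendRight_sq (h : IsBraidedPair q e f) (j : Fin (n + 1)) :
    extendRight q e f j * extendRight q e f j = 0 := by
  refine Fin.cases ?_ (fun j => ?_) j
  · ext a b; fin_cases a <;> fin_cases b <;>
      simp [Matrix.mul_apply, Fin.sum_univ_four, newRight]
  · have h1 := h.right.sq j
    have h2 := h.same j
    ext a b; fin_cases a <;> fin_cases b <;>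
      simp [Matrix.mul_apply, Fin.sum_univ_four, oldRight, h1, h2]

lemma IsBraidedPair.extendRight_anti (hq : q ≠ 0) (h : IsBraidedPair q e f) {j l : Fin (n + 1)} : j < l →
    extendRight q e f l * extendRight q e f j =
      (-q) • (extendRight q e f j * extendRight q e f l) := by
  refine Fin.cases ?_ (fun j => ?_) j <;> refine Fin.cases ?_ (fun l => ?_) l
  · simp
  · intro _
    ext a b; fin_cases a <;> fin_cases b <;>
      simp [Matrix.mul_apply, Fin.sum_univ_four, newRight, oldRight]
    all_goals module
  · simp
  · intro hjl
    have h1 := h.right.anti (Fin.succ_lt_succ_iff.1 hjl)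
    have h2 := h.up (Fin.succ_lt_succ_iff.1 hjl)
    have h3 := h.down (Fin.succ_lt_succ_iff.1 hjl)
    ext a b; fin_cases a <;> fin_cases b <;>
      simp [Matrix.mul_apply, Fin.sum_univ_four, oldRight, h1, h2, h3]
    all_goals (match_scalars <;> field_simp <;> ring)

lemma IsBraidedPair.extend_same (hq : q ≠ 0) (h : IsBraidedPair q e f) (j : Fin (n + 1)) :
    extendLeft q e j * extendRight q e f j =
      q • (extendRight q e f j * extendLeft q e j) := by
  refine Fin.cases ?_ (fun j => ?_) j
  · ext a b; fin_cases a <;> fin_cases b <;>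
      simp [Matrix.mul_apply, Fin.sum_univ_four, newLeft, newRight, hq]
  · have h1 := h.left.sq j
    have h2 := h.same j
    ext a b; fin_cases a <;> fin_cases b <;>
      simp [Matrix.mul_apply, Fin.sum_univ_four, oldLeft, oldRight, h1, h2]

lemma IsBraidedPair.extend_up (hq : q ≠ 0) (h : IsBraidedPair q e f) {j l : Fin (n + 1)} : j < l →
    extendLeft q e j * extendRight q e f l =
      extendRight q e f l * extendLeft q e j +
        (q - q⁻¹) • (extendRight q e f j * extendLeft q e l) := by
  refine Fin.cases ?_ (fun j => ?_) j <;> refine Fin.cases ?_ (fun l => ?_) l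
  · simp
  · intro _
    ext a b; fin_cases a <;> fin_cases b <;>
      simp [Matrix.mul_apply, Fin.sum_univ_four, newLeft, newRight, oldLeft, oldRight]
    all_goals (match_scalars <;> field_simp <;> ring)
  · simp
  · intro hjl
    have h1 := h.left.anti (Fin.succ_lt_succ_iff.1 hjl)
    have h2 := h.up (Fin.succ_lt_succ_iff.1 hjl)
    ext a b; fin_cases a <;> fin_cases b <;>
      simp [Matrix.mul_apply, Fin.sum_univ_four, oldLeft, oldRight, h1, h2]
    all_goals (match_scalars <;> field_simp <;> ring)

lemma IsBraidedPair.extend_down (h : IsBraidedPair q e f) {j l : Fin (n + 1)} : j < l →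
    extendLeft q e l * extendRight q e f j =
      extendRight q e f j * extendLeft q e l := by
  refine Fin.cases ?_ (fun j => ?_) j <;> refine Fin.cases ?_ (fun l => ?_) l
  · simp
  · intro _
    ext a b; fin_cases a <;> fin_cases b <;>
      simp [Matrix.mul_apply, Fin.sum_univ_four, newRight, oldLeft]
    all_goals module
  · simp
  · intro hjl
    have h1 := h.left.anti (Fin.succ_lt_succ_iff.1 hjl)
    have h3 := h.down (Fin.succ_lt_succ_iff.1 hjl)
    ext a b; fin_cases a <;> fin_cases b <;>
      simp [Matrix.mul_apply, Fin.sum_univ_four, oldLeft, oldRight, h1, h3]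
    all_goals module

/-- The matrices are left multiplications on four copies of `E`, indexed by `1, f, e, ef` for a new
smallest letter, with old coefficients on the right. Their entries record how a letter passes these
basis elements under the desired relations; associativity comes for free from matrices. -/
lemma IsBraidedPair.extend (hq : q ≠ 0) (h : IsBraidedPair q e f) :
    IsBraidedPair q (extendLeft q e) (extendRight q e f) :=
  ⟨⟨h.extendLeft_sq, h.extendLeft_anti⟩, ⟨h.extendRight_sq, h.extendRight_anti hq⟩,
    h.extend_same hq, h.extend_up hq, h.extend_down⟩


open Matrix in
lemma oldLeft_mulVec (x y : E) (a : Fin 2) :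
    oldLeft q x *ᵥ Pi.single (a.castLE (by simp)) y = Pi.single (a.castLE (by simp)) (x * y) := by
  ext b
  fin_cases a <;> fin_cases b <;> simp [oldLeft]

open Matrix in
lemma oldRight_mulVec (x y z : E) :
    oldRight q x y *ᵥ Pi.single 0 z = Pi.single 0 (y * z) := by
  ext b
  fin_cases b <;> simp [oldRight]

open Matrix in
lemma newRight_mulVec (z : E) : newRight q E *ᵥ Pi.single 0 z = Pi.single 1 z := by
  ext b
  fin_cases b <;> simp [newRight]

open Matrix in
lemma newLeft_mulVec (z : E) (a : Fin 2) :
    newLeft E *ᵥ Pi.single (a.castLE (by simp)) z = Pi.single (Fin.natAdd 2 a) z := by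
  ext b
  fin_cases a <;> fin_cases b <;> simp [newLeft]

-- Only the slots `1` and `f` matter: the word in the second family acts first and leads nowhere
-- else. On these slots an old letter of the first family passes without a scalar.
open Matrix in
lemma wordProd_extendLeft_mulVec (u : List (Fin n)) (a : Fin 2) (y : E) :
    wordProd (extendLeft q e) (u.map Fin.succ) *ᵥ Pi.single (a.castLE (by simp)) y =
      Pi.single (a.castLE (by simp)) (wordProd e u * y) := by
  induction u with
  | nil => simp only [List.map_nil, wordProd_nil, one_mulVec, one_mul]
  | cons j u ih =>
    rw [List.map_cons, wordProd_cons, ← mulVec_mulVec, ih, extendLeft_succ, oldLeft_mulVec,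
      wordProd_cons, mul_assoc]

open Matrix in
lemma wordProd_extendRight_mulVec (v : List (Fin n)) (y : E) :
    wordProd (extendRight q e f) (v.map Fin.succ) *ᵥ Pi.single 0 y =
      Pi.single 0 (wordProd f v * y) := by
  induction v with
  | nil => simp only [List.map_nil, wordProd_nil, one_mulVec, one_mul]
  | cons j u ih =>
    rw [List.map_cons, wordProd_cons, ← mulVec_mulVec, ih, extendRight_succ, oldRight_mulVec,
      wordProd_cons, mul_assoc]

/-- The word obtained from `u` by shifting the letters and prepending `0` if `b` holds. -/
def shiftWord (b : Bool) (u : List (Fin n)) : List (Fin (n + 1)) :=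
  if b then 0 :: u.map Fin.succ else u.map Fin.succ

lemma shiftWord_inj {b b' : Bool} {u u' : List (Fin n)} :
    shiftWord b u = shiftWord b' u' ↔ b = b' ∧ u = u' := by
  have hinj : Function.Injective (List.map (Fin.succ (n := n))) :=
    List.map_injective_iff.2 (Fin.succ_injective n)
  have hne : ∀ (w w' : List (Fin n)), 0 :: w.map Fin.succ ≠ w'.map Fin.succ := by
    intro w w' h
    have : (0 : Fin (n + 1)) ∈ w'.map Fin.succ := h ▸ List.mem_cons_self
    simp at this
  cases b <;> cases b' <;> simp [shiftWord, hinj.eq_iff, hne, (hne _ _).symm]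

lemma exists_shiftWord {u : List (Fin (n + 1))} (hu : u.Pairwise (· < ·)) :
    ∃ b u', u'.Pairwise (· < ·) ∧ u = shiftWord b u' := by
  have key : ∀ w : List (Fin (n + 1)), w.Pairwise (· < ·) → (∀ j ∈ w, 0 < j) →
      ∃ w' : List (Fin n), w'.Pairwise (· < ·) ∧ w = w'.map Fin.succ := by
    intro w hw h0
    have : w ∈ Set.range (List.map (Fin.succ (n := n))) := by
      rw [Set.range_list_map]
      intro j hj
      exact Fin.exists_succ_eq.2 (h0 j hj).ne'
    obtain ⟨w', rfl⟩ := this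
    refine ⟨w', ?_, rfl⟩
    simpa [List.pairwise_map] using hw
  cases u with
  | nil => exact ⟨false, [], .nil, rfl⟩
  | cons j u =>
    rw [List.pairwise_cons] at hu
    by_cases hj : j = 0
    · subst hj
      obtain ⟨w, hw, rfl⟩ := key u hu.2 hu.1
      exact ⟨true, w, hw, rfl⟩
    · have hj' : 0 < j := Fin.pos_iff_ne_zero.2 hj
      obtain ⟨w, hw, h⟩ := key (j :: u) (List.pairwise_cons.2 hu) (by
        intro i hi
        rcases List.mem_cons.1 hi with rfl | hi
        · exact hj'
        · exact hj'.trans (hu.1 i hi))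
      exact ⟨false, w, hw, h⟩

/-- The basis vector among `1, f, e, ef` with the given exponents. -/
def cornerIndex : Bool → Bool → Fin 4
  | false, false => 0
  | false, true => 1
  | true, false => 2
  | true, true => 3

lemma cornerIndex_inj {b b' c c' : Bool} :
    cornerIndex b c = cornerIndex b' c' ↔ b = b' ∧ c = c' := by
  revert b b' c c'; decide

-- The first column is the image of the basis vector `1`. New letters stand at the front of their
-- words, so each acts after the old letters of its family and merely moves the result to another
-- slot, with no scalar.
open Matrix in
lemma wordProd_extend_apply (b c : Bool) (u v : List (Fin n)) (i : Fin 4) :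
    (wordProd (extendLeft q e) (shiftWord b u) * wordProd (extendRight q e f) (shiftWord c v)) i 0 =
      if i = cornerIndex b c then wordProd e u * wordProd f v else 0 := by
  have h0 : ∀ M : Matrix (Fin 4) (Fin 4) E, M i 0 = (M *ᵥ Pi.single 0 1) i := by simp
  have h1 : ∀ y : E, wordProd (extendLeft q e) (u.map Fin.succ) *ᵥ Pi.single 0 y =
      Pi.single 0 (wordProd e u * y) := wordProd_extendLeft_mulVec u 0
  have h2 : ∀ y : E, wordProd (extendLeft q e) (u.map Fin.succ) *ᵥ Pi.single 1 y =
      Pi.single 1 (wordProd e u * y) := wordProd_extendLeft_mulVec u 1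
  have h3 : ∀ y : E, newLeft E *ᵥ Pi.single 0 y = Pi.single 2 y := fun y => newLeft_mulVec y 0
  have h4 : ∀ y : E, newLeft E *ᵥ Pi.single 1 y = Pi.single 3 y := fun y => newLeft_mulVec y 1
  refine (h0 _).trans ?_
  rw [← mulVec_mulVec]
  cases b <;> cases c <;>
    simp only [shiftWord, cornerIndex, wordProd_cons, extendLeft_zero, extendRight_zero,
      ← mulVec_mulVec, wordProd_extendRight_mulVec, h1, h2, h3, h4, newRight_mulVec,
      Pi.single_apply, mul_one, if_true, Bool.false_eq_true, if_false] <;> rfl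

end Construction

end Exterior

/-- A braided pair whose ordered monomials are linearly independent. -/
theorem exists_braidedPair.{u} {k : Type u} [Field k] {q : k} (hq : q ≠ 0) (n : ℕ) :
    ∃ (E : Type u) (_ : Ring E) (_ : Algebra k E) (e f : Fin n → E), IsBraidedPair q e f ∧
      ∀ I J : List (Fin n), I.Pairwise (· < ·) → J.Pairwise (· < ·) →
        ∃ θ : E →ₗ[k] k, ∀ u v : List (Fin n), u.Pairwise (· < ·) → v.Pairwise (· < ·) →
          θ (wordProd e u * wordProd f v) = if u = I ∧ v = J then 1 else 0 := by
  induction n with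
  | zero =>
    refine ⟨k, inferInstance, inferInstance, Fin.elim0, Fin.elim0, ?_, fun I J _ _ => ?_⟩
    · exact ⟨⟨fun j => j.elim0, fun {j} => j.elim0⟩, ⟨fun j => j.elim0, fun {j} => j.elim0⟩,
        fun j => j.elim0, fun {j} => j.elim0, fun {j} => j.elim0⟩
    · refine ⟨LinearMap.id, fun u v _ _ => ?_⟩
      have : ∀ w : List (Fin 0), w = [] := fun w => by
        cases w with
        | nil => rfl
        | cons j _ => exact j.elim0
      simp [this u, this v, this I, this J]
  | succ n ih =>
    obtain ⟨E, _, _, e, f, h, hθ⟩ := ih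
    refine ⟨Matrix (Fin 4) (Fin 4) E, inferInstance, inferInstance, extendLeft q e,
      extendRight q e f, h.extend hq, fun I J hI hJ => ?_⟩
    obtain ⟨b, I, hI', rfl⟩ := exists_shiftWord hI
    obtain ⟨c, J, hJ', rfl⟩ := exists_shiftWord hJ
    obtain ⟨θ, hθ⟩ := hθ I J hI' hJ'
    -- The row of the entry detects which new letters occur, and the old `θ` detects the remaining
    -- letters.
    refine ⟨θ ∘ₗ Matrix.entryLinearMap k E (cornerIndex b c) 0, fun u v hu hv => ?_⟩
    obtain ⟨b', u, hu', rfl⟩ := exists_shiftWord hu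
    obtain ⟨c', v, hv', rfl⟩ := exists_shiftWord hv
    rw [LinearMap.comp_apply, Matrix.entryLinearMap_apply, wordProd_extend_apply]
    simp only [apply_ite θ, map_zero, hθ u v hu' hv', cornerIndex_inj, shiftWord_inj]
    split_ifs <;> grind

/-! ### Words in quantum exterior algebras -/

section Words

variable {k : Type*} [Field k] {q : k} {α E : Type*} [LinearOrder α] [Ring E] [Algebra k E]
  {e f : α → E}

lemma IsQuantumExterior.exists_smul (hq : q ≠ 0) (h : IsQuantumExterior q e) {a b : α}
    (hab : a ≠ b) : ∃ c : k, e a * e b = c • (e b * e a) := by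
  rcases lt_or_gt_of_ne hab with hlt | hlt
  · refine ⟨(-q)⁻¹, ?_⟩
    rw [h.anti hlt, smul_smul, inv_mul_cancel₀ (neg_ne_zero.2 hq), one_smul]
  · exact ⟨-q, h.anti hlt⟩

/-- The letter moves, up to scalars, until it meets its equal, and squares vanish. -/
lemma IsQuantumExterior.mul_wordProd_eq_zero (hq : q ≠ 0) (h : IsQuantumExterior q e) {a : α}
    {w : List α} (ha : a ∈ w) : e a * wordProd e w = 0 := by
  induction w with
  | nil => simp at ha
  | cons b w ih =>
    rw [wordProd_cons, ← mul_assoc]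
    by_cases hab : a = b
    · rw [hab, h.sq, zero_mul]
    · obtain ⟨c, hc⟩ := h.exists_smul hq hab
      rw [hc, smul_mul_assoc, mul_assoc, ih ((List.mem_cons.1 ha).resolve_left hab), mul_zero,
        smul_zero]

lemma IsQuantumExterior.wordProd_eq_zero (hq : q ≠ 0) (h : IsQuantumExterior q e)
    {w : List α} (hw : ¬ w.Nodup) : wordProd e w = 0 := by
  induction w with
  | nil => simp at hw
  | cons a w ih =>
    rw [wordProd_cons]
    by_cases ha : a ∈ w
    · exact h.mul_wordProd_eq_zero hq ha
    · rw [ih (by simpa [ha] using hw), mul_zero]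

/-- The number of inversions of a word. -/
def inversions : List α → ℕ
  | [] => 0
  | a :: w => w.countP (· < a) + inversions w

lemma IsQuantumExterior.mul_wordProd_sorted (h : IsQuantumExterior q e) (a : α) {w : List α}
    (hw : w.Pairwise (· ≤ ·)) :
    e a * wordProd e w = (-q) ^ w.countP (· < a) • wordProd e (w.orderedInsert (· ≤ ·) a) := by
  induction w with
  | nil => simp
  | cons b w ih =>
    rw [List.pairwise_cons] at hw
    by_cases hab : a ≤ b
    · have : (b :: w).countP (· < a) = 0 := by
        rw [List.countP_eq_zero]
        intro c hc
        rcases List.mem_cons.1 hc with rfl | hc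
        · simpa using hab
        · simpa using hab.trans (hw.1 c hc)
      rw [this, List.orderedInsert_cons, if_pos hab]
      simp
    · rw [List.orderedInsert_cons, if_neg hab, wordProd_cons, wordProd_cons, ← mul_assoc,
        h.anti (not_le.1 hab), smul_mul_assoc, mul_assoc, ih hw.2, mul_smul_comm, smul_smul,
        List.countP_cons_of_pos (by simpa using hab), pow_succ']

/-- Insertion sort moves each letter past exactly the strictly smaller ones to its right, at the
price of `-q` each. This is the source of the coefficients of quantum minors. -/
lemma IsQuantumExterior.wordProd_eq_sorted (h : IsQuantumExterior q e) (w : List α) :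
    wordProd e w = (-q) ^ inversions w • wordProd e (w.insertionSort (· ≤ ·)) := by
  induction w with
  | nil => simp [inversions]
  | cons a w ih =>
    rw [wordProd_cons, ih, mul_smul_comm,
      h.mul_wordProd_sorted a (List.pairwise_insertionSort _ w), smul_smul,
      List.insertionSort_cons, inversions, pow_add, mul_comm,
      (List.perm_insertionSort (· ≤ ·) w).countP_eq]

lemma inversions_ofFn {m : ℕ} (g : Fin m → α) :
    inversions (List.ofFn g) =
      (Finset.univ.filter fun p : Fin m × Fin m => p.1 < p.2 ∧ g p.2 < g p.1).card := by
  have key : ∀ {m : ℕ} (g : Fin m → α) (a : α),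
      (List.ofFn g).countP (· < a) = ∑ i, if g i < a then 1 else 0 := by
    intro m g a
    induction m with
    | zero => simp
    | succ m ih =>
      rw [List.ofFn_succ, List.countP_cons, ih, Fin.sum_univ_succ, add_comm]
      simp
  induction m with
  | zero => simp [inversions]
  | succ m ih =>
    rw [List.ofFn_succ, inversions, ih, key]
    rw [Finset.card_filter, Finset.card_filter]
    simp [Fintype.sum_prod_type, Fin.sum_univ_succ, -Finset.sum_boole]

lemma IsQuantumExterior.wordProd_perm {m : ℕ} (h : IsQuantumExterior q e) (J : Fin m ↪o α)
    (σ : Equiv.Perm (Fin m)) :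
    wordProd e (List.ofFn fun a => J (σ a)) =
      (-q) ^ permLength σ • wordProd e (List.ofFn J) := by
  rw [h.wordProd_eq_sorted, inversions_ofFn]
  congr 2
  · simp [permLength]
  · refine List.Perm.eq_of_pairwise' (r := (· ≤ ·)) (List.pairwise_insertionSort _ _) ?_
      ((List.perm_insertionSort _ _).trans (Equiv.Perm.ofFn_comp_perm σ J))
    rw [List.pairwise_ofFn]
    exact fun a b hab => J.monotone hab.le

/-! ### Exchanging words of a braided pair -/

lemma IsBraidedPair.mul_wordProd_of_lt (h : IsBraidedPair q e f) {a : α} {w : List α}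
    (hw : ∀ b ∈ w, b < a) : e a * wordProd f w = wordProd f w * e a := by
  induction w with
  | nil => simp
  | cons b w ih =>
    rw [wordProd_cons, ← mul_assoc, h.down (hw b (by simp)), mul_assoc,
      ih fun c hc => hw c (by simp [hc]), mul_assoc]

/-- The prefix `f a` kills the correction term of `up`, which begins with another `f a`. -/
lemma IsBraidedPair.mul_wordProd_of_gt (hq : q ≠ 0) (h : IsBraidedPair q e f) {a : α} {w : List α}
    (hw : ∀ b ∈ w, a < b) : f a * e a * wordProd f w = f a * wordProd f w * e a := by
  induction w with
  | nil => simp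
  | cons b w ih =>
    have hab := hw b (by simp)
    obtain ⟨c, hc⟩ := h.right.exists_smul hq hab.ne
    calc f a * e a * wordProd f (b :: w)
        = f a * (e a * f b) * wordProd f w := by simp only [wordProd_cons, mul_assoc]
      _ = f a * f b * e a * wordProd f w := by
          rw [h.up hab, mul_add, mul_smul_comm, ← mul_assoc (f a) (f a), h.right.sq, zero_mul,
            smul_zero, add_zero, ← mul_assoc]
      _ = c • (f b * (f a * e a * wordProd f w)) := by
          simp only [hc, smul_mul_assoc, mul_assoc]
      _ = f a * wordProd f (b :: w) * e a := by
          rw [ih fun x hx => hw x (by simp [hx]), wordProd_cons, ← mul_assoc (f a), hc]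
          simp only [smul_mul_assoc, mul_assoc]

/-- Split `w` at `a`: smaller letters are passed freely, `f a` itself gives the factor `q`, and once
it stands on the left the larger letters are passed freely as well. -/
lemma IsBraidedPair.mul_wordProd_of_mem (hq : q ≠ 0) (h : IsBraidedPair q e f) {a : α}
    {w : List α} (hw : w.Pairwise (· < ·)) (ha : a ∈ w) :
    e a * wordProd f w = q • (wordProd f w * e a) := by
  obtain ⟨s, t, rfl⟩ := List.append_of_mem ha
  rw [List.pairwise_append, List.pairwise_cons] at hw
  have h1 := h.mul_wordProd_of_lt fun b hb => hw.2.2 b hb a (by simp)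
  have h2 := h.mul_wordProd_of_gt hq hw.2.1.1
  calc e a * wordProd f (s ++ a :: t)
      = wordProd f s * (e a * f a) * wordProd f t := by
        rw [wordProd_append, wordProd_cons, ← mul_assoc, h1]; simp only [mul_assoc]
    _ = q • (wordProd f s * (f a * e a * wordProd f t)) := by
        rw [h.same]; simp only [smul_mul_assoc, mul_smul_comm, mul_assoc]
    _ = q • (wordProd f (s ++ a :: t) * e a) := by
        rw [h2, wordProd_append, wordProd_cons]; simp only [mul_assoc]

lemma IsBraidedPair.wordProd_mul_wordProd (hq : q ≠ 0) (h : IsBraidedPair q e f)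
    {v w : List α} (hw : w.Pairwise (· < ·)) (hv : v ⊆ w) :
    wordProd e v * wordProd f w = q ^ v.length • (wordProd f w * wordProd e v) := by
  induction v with
  | nil => simp
  | cons a v ih =>
    rw [List.cons_subset] at hv
    rw [wordProd_cons, mul_assoc, ih hv.2, mul_smul_comm, ← mul_assoc,
      h.mul_wordProd_of_mem hq hw hv.1, smul_mul_assoc, smul_smul, mul_assoc, List.length_cons,
      pow_succ]

end Words

/-! ### Triangularity of reordering the two families -/

section Triangular

variable {k : Type*} [Field k] {q : k} {n : ℕ} {E : Type*} [Ring E] [Algebra k E]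
  {e f : Fin n → E}

/-- The sum of the letters of a word. -/
def letterSum (w : List (Fin n)) : ℕ := (w.map Fin.val).sum

@[simp] lemma letterSum_cons (a : Fin n) (w : List (Fin n)) :
    letterSum (a :: w) = a + letterSum w := by simp [letterSum]

lemma List.Perm.letterSum_eq {v w : List (Fin n)} (h : v.Perm w) : letterSum v = letterSum w :=
  (h.map _).sum_eq

/-- The only correction comes from `up`, which exchanges the indices of the two letters: the letter
of the second family becomes smaller while the total of all letters is preserved. -/
lemma IsBraidedPair.letter_mul_wordProd (hq : q ≠ 0) (h : IsBraidedPair q e f) (b : Fin n)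
    (u : List (Fin n)) : ∃ c : k, c ≠ 0 ∧ f b * wordProd e u - c • (wordProd e u * f b) ∈
      Submodule.span k {x | ∃ (u' : List (Fin n)) (b' : Fin n),
        letterSum u' + b' = letterSum u + b ∧ b' < b ∧ x = wordProd e u' * f b'} := by
  have hmul : ∀ (j : Fin n) {u : List (Fin n)} {b : Fin n} {x : E},
      x ∈ Submodule.span k {x | ∃ (u' : List (Fin n)) (b' : Fin n),
        letterSum u' + b' = letterSum u + b ∧ b' < b ∧ x = wordProd e u' * f b'} →
      e j * x ∈ Submodule.span k {x | ∃ (u' : List (Fin n)) (b' : Fin n),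
        letterSum u' + b' = letterSum (j :: u) + b ∧ b' < b ∧ x = wordProd e u' * f b'} := by
    intro j u b x hx
    refine Submodule.span_induction (p := fun x _ => e j * x ∈ _) ?_ (by simp) ?_ ?_ hx
    · rintro _ ⟨u', b', h1, h2, rfl⟩
      exact Submodule.subset_span ⟨j :: u', b', by simp only [letterSum_cons]; omega, h2,
        by simp [mul_assoc]⟩
    · intro x y _ _ hx hy; rw [mul_add]; exact add_mem hx hy
    · intro c x _ hx; rw [mul_smul_comm]; exact Submodule.smul_mem _ _ hx
  induction u generalizing b with
  | nil => exact ⟨1, one_ne_zero, by simp⟩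
  | cons j u ih =>
    obtain ⟨c, hc, ihc⟩ := ih b
    have h1 := hmul j ihc
    rcases lt_trichotomy j b with hjb | rfl | hjb
    · obtain ⟨d, -, ihd⟩ := ih j
      have h2 := Submodule.span_mono (t := {x | ∃ (u' : List (Fin n)) (b' : Fin n),
        letterSum u' + b' = letterSum (j :: u) + b ∧ b' < b ∧ x = wordProd e u' * f b'}) (by
        rintro _ ⟨u', b', h3, h4, rfl⟩
        refine ⟨u', b', ?_, h4.trans hjb, rfl⟩
        simp only [letterSum_cons] at h3 ⊢
        omega) (hmul b ihd)
      have h3 : wordProd e (b :: u) * f j ∈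
          Submodule.span k {x | ∃ (u' : List (Fin n)) (b' : Fin n),
            letterSum u' + b' = letterSum (j :: u) + b ∧ b' < b ∧ x = wordProd e u' * f b'} :=
        Submodule.subset_span ⟨b :: u, j, by simp only [letterSum_cons]; omega, hjb, rfl⟩
      refine ⟨c, hc, ?_⟩
      have h4 : f b * e j = e j * f b - (q - q⁻¹) • (e b * f j) := by
        rw [h.up hjb, h.down hjb, add_sub_cancel_right]
      have h5 := sub_mem h1 (Submodule.smul_mem _ (q - q⁻¹)
        (add_mem h2 (Submodule.smul_mem _ d h3)))
      convert h5 using 1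
      simp only [wordProd_cons, ← mul_assoc, h4, sub_mul, smul_mul_assoc, mul_sub, mul_smul_comm]
      module
    · refine ⟨q⁻¹ * c, mul_ne_zero (inv_ne_zero hq) hc, ?_⟩
      have h4 : f j * e j = q⁻¹ • (e j * f j) := by
        rw [h.same, smul_smul, inv_mul_cancel₀ hq, one_smul]
      have h5 := Submodule.smul_mem _ q⁻¹ h1
      convert h5 using 1
      simp only [wordProd_cons, ← mul_assoc, h4, smul_mul_assoc, mul_sub, mul_smul_comm]
      module
    · refine ⟨c, hc, ?_⟩
      convert h1 using 1
      simp only [wordProd_cons, ← mul_assoc, ← h.down hjb, mul_sub, mul_smul_comm]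

/-- Moving the second family past the first one produces only terms in which the letters of the
second family have become smaller. -/
lemma IsBraidedPair.wordProd_mul_wordProd_sub_mem (hq : q ≠ 0) (h : IsBraidedPair q e f)
    (v u : List (Fin n)) :
    ∃ c : k, c ≠ 0 ∧ wordProd f v * wordProd e u - c • (wordProd e u * wordProd f v) ∈
      Submodule.span k {x | ∃ u' v' : List (Fin n),
        letterSum u' + letterSum v' = letterSum u + letterSum v ∧ letterSum v' < letterSum v ∧
        x = wordProd e u' * wordProd f v'} := by
  induction v with
  | nil => exact ⟨1, one_ne_zero, by simp⟩
  | cons b v ih =>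
    obtain ⟨c, hc, ihc⟩ := ih
    set G := Submodule.span k {x | ∃ u' v' : List (Fin n),
        letterSum u' + letterSum v' = letterSum u + letterSum (b :: v) ∧
        letterSum v' < letterSum (b :: v) ∧ x = wordProd e u' * wordProd f v'} with hG
    have key : ∀ (u' v' : List (Fin n)), letterSum u' + letterSum v' = letterSum u + letterSum v →
        letterSum v' ≤ letterSum v → ∃ d : k, d ≠ 0 ∧
        f b * (wordProd e u' * wordProd f v') - d • (wordProd e u' * wordProd f (b :: v')) ∈ G := by
      intro u' v' h1 h2
      obtain ⟨d, hd, hdm⟩ := h.letter_mul_wordProd hq b u'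
      refine ⟨d, hd, ?_⟩
      have : (f b * wordProd e u' - d • (wordProd e u' * f b)) * wordProd f v' ∈ G := by
        refine Submodule.span_induction (p := fun x _ => x * wordProd f v' ∈ G) ?_ (by simp) ?_ ?_
          hdm
        · rintro _ ⟨u'', b', h3, h4, rfl⟩
          have h4' : (b' : ℕ) < b := h4
          refine Submodule.subset_span ⟨u'', b' :: v', ?_, ?_, by simp [mul_assoc]⟩ <;>
            simp only [letterSum_cons] <;> omega
        · intro x y _ _ hx hy; rw [add_mul]; exact add_mem hx hy
        · intro a x _ hx; rw [smul_mul_assoc]; exact Submodule.smul_mem _ _ hx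
      simpa only [sub_mul, smul_mul_assoc, mul_assoc, wordProd_cons] using this
    have hlow : ∀ x ∈ Submodule.span k {x | ∃ u' v' : List (Fin n),
        letterSum u' + letterSum v' = letterSum u + letterSum v ∧ letterSum v' < letterSum v ∧
        x = wordProd e u' * wordProd f v'}, f b * x ∈ G := by
      intro x hx
      refine Submodule.span_induction (p := fun x _ => f b * x ∈ G) ?_ (by simp) ?_ ?_ hx
      · rintro _ ⟨u', v', h1, h2, rfl⟩
        obtain ⟨d, -, hd⟩ := key u' v' h1 h2.le
        have h3 : wordProd e u' * wordProd f (b :: v') ∈ G := by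
          refine Submodule.subset_span ⟨u', b :: v', ?_, ?_, rfl⟩ <;>
            simp only [letterSum_cons] <;> omega
        simpa using add_mem hd (Submodule.smul_mem _ d h3)
      · intro x y _ _ hx hy; rw [mul_add]; exact add_mem hx hy
      · intro a x _ hx; rw [mul_smul_comm]; exact Submodule.smul_mem _ _ hx
    obtain ⟨d, hd, hdm⟩ := key u v rfl le_rfl
    refine ⟨c * d, mul_ne_zero hc hd, ?_⟩
    have := add_mem (hlow _ ihc) (Submodule.smul_mem _ c hdm)
    convert this using 1
    simp only [wordProd_cons, mul_sub, mul_smul_comm, mul_assoc]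
    module

/-- A functional dual to a sorted monomial vanishes on words with other letter sums. -/
lemma IsBraidedPair.functional_eq_zero (hq : q ≠ 0) (h : IsBraidedPair q e f)
    {I J : List (Fin n)} {θ : E →ₗ[k] k}
    (hθ : ∀ u v : List (Fin n), u.Pairwise (· < ·) → v.Pairwise (· < ·) →
      θ (wordProd e u * wordProd f v) = if u = I ∧ v = J then 1 else 0)
    {u v : List (Fin n)} (huv : letterSum u ≠ letterSum I ∨ letterSum v ≠ letterSum J) :
    θ (wordProd e u * wordProd f v) = 0 := by
  by_cases hu : u.Nodup
  swap
  · rw [h.left.wordProd_eq_zero hq hu, zero_mul, map_zero]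
  by_cases hv : v.Nodup
  swap
  · rw [h.right.wordProd_eq_zero hq hv, mul_zero, map_zero]
  have pu := List.perm_insertionSort (· ≤ ·) u
  have pv := List.perm_insertionSort (· ≤ ·) v
  have hsort : ∀ w : List (Fin n), w.Nodup → (w.insertionSort (· ≤ ·)).Pairwise (· < ·) := by
    intro w hw
    refine ((List.pairwise_insertionSort (· ≤ ·) w).and
      ((List.perm_insertionSort (· ≤ ·) w).nodup_iff.2 hw)).imp ?_
    rintro a b ⟨h1, h2⟩
    exact lt_of_le_of_ne h1 h2
  rw [h.left.wordProd_eq_sorted u, h.right.wordProd_eq_sorted v, smul_mul_assoc, mul_smul_comm,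
    map_smul, map_smul, hθ _ _ (hsort u hu) (hsort v hv), if_neg, smul_zero, smul_zero]
  rintro ⟨rfl, rfl⟩
  exact huv.elim (fun h => h pu.symm.letterSum_eq) fun h => h pv.symm.letterSum_eq

end Triangular

/-! ### The coaction of quantum matrices on a braided pair -/

section Coaction

set_option linter.unnecessarySeqFocus false

variable {k : Type*} [Field k] {q : k} {m n : ℕ} {T : Type*} [Ring T] [Algebra k T]
  {x : Fin m → Fin n → T} {e f : Fin n → T}

/-- The quadratic relations mix the column pair `(j, l)` only with `(l, j)`, so double sums are
compared after grouping these two terms. -/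
lemma sum_sum_eq_of_pairs {M : Type*} [AddCommMonoid M] {A B : Fin n → Fin n → M}
    (hd : ∀ j, A j j = B j j) (ho : ∀ j l, j < l → A j l + A l j = B j l + B l j) :
    ∑ j, ∑ l, A j l = ∑ j, ∑ l, B j l := by
  have key : ∀ A : Fin n → Fin n → M, ∑ j, ∑ l, A j l =
      ∑ j, A j j + ∑ j, ∑ l, if j < l then A j l + A l j else 0 := by
    intro A
    have h1 : ∀ j l, A j l = (if j = l then A j l else 0) + ((if j < l then A j l else 0) +
        (if l < j then A j l else 0)) := by
      intro j l
      rcases lt_trichotomy j l with h | rfl | h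
      · simp [h, h.ne, h.not_gt]
      · simp
      · simp [h, h.ne', h.not_gt]
    have h2 : ∑ j, ∑ l, (if l < j then A j l else 0) = ∑ j, ∑ l, if j < l then A l j else 0 :=
      Finset.sum_comm
    calc ∑ j, ∑ l, A j l = ∑ j, ∑ l, ((if j = l then A j l else 0) +
          ((if j < l then A j l else 0) + (if l < j then A j l else 0))) :=
          Finset.sum_congr rfl fun j _ => Finset.sum_congr rfl fun l _ => h1 j l
      _ = ∑ j, A j j + (∑ j, ∑ l, (if j < l then A j l else 0) +
          ∑ j, ∑ l, if j < l then A l j else 0) := by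
          simp only [Finset.sum_add_distrib, h2]; simp
      _ = ∑ j, A j j + ∑ j, ∑ l, if j < l then A j l + A l j else 0 := by
          rw [← Finset.sum_add_distrib]
          refine congrArg _ (Finset.sum_congr rfl fun j _ => ?_)
          rw [← Finset.sum_add_distrib]
          refine Finset.sum_congr rfl fun l _ => ?_
          split_ifs <;> simp
  rw [key A, key B]
  congr 1
  · exact Finset.sum_congr rfl fun j _ => hd j
  · refine Finset.sum_congr rfl fun j _ => Finset.sum_congr rfl fun l _ => ?_
    split_ifs with h
    · exact ho j l h
    · rfl

lemma sum_mul_sum_of_commute (hc : ∀ i j l, Commute (x i j) (e l)) (i r : Fin m) :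
    (∑ j, x i j * e j) * (∑ l, x r l * f l) = ∑ j, ∑ l, (x i j * x r l) * (e j * f l) := by
  rw [Finset.sum_mul_sum]
  refine Finset.sum_congr rfl fun j _ => Finset.sum_congr rfl fun l _ => ?_
  rw [mul_assoc, ← mul_assoc (e j), ← (hc r l j).eq]
  simp only [mul_assoc]

lemma IsQuantumMatrix.coact_exterior (hq : q ≠ 0) (hx : IsQuantumMatrix q (fun _ _ => True) x)
    (h : IsQuantumExterior q e) (hc : ∀ i j l, Commute (x i j) (e l)) :
    IsQuantumExterior q fun i => ∑ j, x i j * e j := by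
  constructor
  · intro i
    rw [sum_mul_sum_of_commute hc]
    refine (sum_sum_eq_of_pairs (B := fun _ _ => 0) (fun j => ?_) fun j l hjl => ?_).trans
      (by simp)
    · rw [h.sq, mul_zero]
    · rw [hx.row hjl trivial trivial, h.anti hjl]
      simp only [smul_mul_assoc, mul_smul_comm]
      module
  · intro i r hir
    rw [sum_mul_sum_of_commute hc, sum_mul_sum_of_commute hc]
    simp only [Finset.smul_sum]
    refine sum_sum_eq_of_pairs (fun j => ?_) fun j l hjl => ?_
    · rw [h.sq, mul_zero, mul_zero, smul_zero]
    · rw [hx.diag hir hjl trivial trivial trivial trivial, hx.anti hir hjl trivial trivial,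
        h.anti hjl]
      simp only [smul_mul_assoc, mul_smul_comm, add_mul]
      match_scalars <;> field_simp <;> ring

/-- For each pair of columns, the relations among the entries convert the relations between the
letters into the same relations between the row sums. -/
lemma IsQuantumMatrix.coact (hq : q ≠ 0) (hx : IsQuantumMatrix q (fun _ _ => True) x)
    (h : IsBraidedPair q e f) (hce : ∀ i j l, Commute (x i j) (e l))
    (hcf : ∀ i j l, Commute (x i j) (f l)) :
    IsBraidedPair q (fun i => ∑ j, x i j * e j) (fun i => ∑ j, x i j * f j) := by
  refine ⟨hx.coact_exterior hq h.left hce, hx.coact_exterior hq h.right hcf, fun i => ?_,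
    fun {i r} hir => ?_, fun {i r} hir => ?_⟩
  · rw [sum_mul_sum_of_commute hce, sum_mul_sum_of_commute hcf]
    simp only [Finset.smul_sum]
    refine sum_sum_eq_of_pairs (fun j => ?_) fun j l hjl => ?_
    · rw [h.same, mul_smul_comm]
    · rw [hx.row hjl trivial trivial, h.up hjl, h.down hjl]
      simp only [smul_mul_assoc, mul_smul_comm, mul_add]
      match_scalars <;> field_simp <;> ring
  · rw [sum_mul_sum_of_commute hce, sum_mul_sum_of_commute hcf, sum_mul_sum_of_commute hcf]
    simp only [Finset.smul_sum, ← Finset.sum_add_distrib]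
    refine sum_sum_eq_of_pairs (fun j => ?_) fun j l hjl => ?_
    · rw [h.same, hx.col hir trivial trivial]
      simp only [smul_mul_assoc, mul_smul_comm]
      match_scalars <;> field_simp <;> ring
    · rw [hx.diag hir hjl trivial trivial trivial trivial, hx.anti hir hjl trivial trivial,
        h.up hjl, h.down hjl]
      simp only [smul_mul_assoc, mul_smul_comm, mul_add, add_mul]
      module
  · rw [sum_mul_sum_of_commute hce, sum_mul_sum_of_commute hcf]
    refine sum_sum_eq_of_pairs (fun j => ?_) fun j l hjl => ?_
    · rw [h.same, hx.col hir trivial trivial]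
      simp only [smul_mul_assoc, mul_smul_comm]
    · rw [hx.diag hir hjl trivial trivial trivial trivial, hx.anti hir hjl trivial trivial,
        h.up hjl, h.down hjl]
      simp only [smul_mul_assoc, mul_smul_comm, mul_add, add_mul]
      module

/-! ### Expansion of the product of all rows in maximal minors -/

lemma prod_ofFn_mul_of_commute {m : ℕ} {a b : Fin m → T} (hc : ∀ i j, Commute (a i) (b j)) :
    (List.ofFn fun i => a i * b i).prod = (List.ofFn a).prod * (List.ofFn b).prod := by
  induction m with
  | zero => simp
  | succ m ih =>
    rw [List.ofFn_succ, List.prod_cons, ih fun i j => hc _ _, List.ofFn_succ, List.ofFn_succ,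
      List.prod_cons, List.prod_cons]
    have : Commute (b 0) (List.ofFn fun i : Fin m => a i.succ).prod := by
      refine Commute.list_prod_right _ _ fun y hy => ?_
      obtain ⟨i, rfl⟩ := List.mem_ofFn.1 hy
      exact (hc _ _).symm
    rw [mul_assoc, mul_assoc, ← mul_assoc (b 0), this.eq, mul_assoc]

lemma range_orderEmbedding_comp_perm {m : ℕ} {α : Type*} [LinearOrder α] :
    Function.Injective (fun p : (Fin m ↪o α) × Equiv.Perm (Fin m) => fun a => p.1 (p.2 a)) ∧
    ∀ g : Fin m → α, Function.Injective g →
      g ∈ Set.range fun p : (Fin m ↪o α) × Equiv.Perm (Fin m) => fun a => p.1 (p.2 a) := by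
  constructor
  · rintro ⟨J, σ⟩ ⟨J', σ'⟩ h
    simp only at h
    have hr : ∀ (J : Fin m ↪o α) (σ : Equiv.Perm (Fin m)),
        Set.range (fun a => J (σ a)) = Set.range J := fun J σ => σ.surjective.range_comp J
    have hJ : J = J' := by
      apply DFunLike.coe_injective
      exact (StrictMono.range_inj J.strictMono J'.strictMono).1 (by rw [← hr J σ, h, hr])
    subst hJ
    have hσ : σ = σ' := Equiv.ext fun a => J.injective (congrFun h a)
    rw [hσ]
  · intro g hg
    have hmono : StrictMono (g ∘ Tuple.sort g) :=
      (Tuple.monotone_sort g).strictMono_of_injective (hg.comp (Tuple.sort g).injective)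
    exact ⟨(OrderEmbedding.ofStrictMono _ hmono, (Tuple.sort g).symm), by
      funext a; simp⟩

/-- Expand multilinearly over column choices. Choices with a repetition vanish; an injective choice
is uniquely an increasing enumeration after a permutation, and sorting its word contributes the sign
`(-q) ^ ℓ(σ)` of the minor. -/
lemma IsQuantumExterior.prod_rows (hq : q ≠ 0) (h : IsQuantumExterior q e)
    (hc : ∀ i j l, Commute (x i j) (e l)) :
    (List.ofFn fun i => ∑ j, x i j * e j).prod =
      ∑ J : Fin m ↪o Fin n, (∑ σ : Equiv.Perm (Fin m),
        (-q) ^ permLength σ • (List.ofFn fun a => x a (J (σ a))).prod) *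
          wordProd e (List.ofFn J) := by
  have h1 := (MultilinearMap.mkPiAlgebraFin k m T).map_sum fun i j => x i j * e j
  simp only [MultilinearMap.mkPiAlgebraFin_apply] at h1
  rw [h1]
  have h2 : ∀ g : Fin m → Fin n, (List.ofFn fun i => x i (g i) * e (g i)).prod =
      (List.ofFn fun i => x i (g i)).prod * wordProd e (List.ofFn g) := by
    intro g
    rw [prod_ofFn_mul_of_commute fun i j => hc _ _ _, wordProd, List.map_ofFn]
    rfl
  simp only [h2, Finset.sum_mul]
  rw [← Fintype.sum_prod_type' (f := fun (J : Fin m ↪o Fin n) (σ : Equiv.Perm (Fin m)) =>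
    ((-q) ^ permLength σ • (List.ofFn fun a => x a (J (σ a))).prod) * wordProd e (List.ofFn J))]
  symm
  refine Fintype.sum_of_injective _ range_orderEmbedding_comp_perm.1 _ _ (fun g hg => ?_) ?_
  · rw [h.wordProd_eq_zero hq, mul_zero]
    intro hnd
    exact hg (range_orderEmbedding_comp_perm.2 g (List.nodup_ofFn.1 hnd))
  · rintro ⟨J, σ⟩
    simp only [h.wordProd_perm, smul_mul_assoc, mul_smul_comm]

end Coaction

/-! ### Exchange relations between maximal minors -/

section Exchange

open scoped TensorProduct

variable {k : Type*} [Field k] {q : k} {m n : ℕ}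

/-- The maximal quantum minor with the given columns. -/
noncomputable def QMat.maxMinor (q : k) (J : Fin m ↪o Fin n) : QMat q m n :=
  QMat.minor q (RelEmbedding.refl _) J

/-- The sum of the columns of a maximal minor. -/
def columnSum (J : Fin m ↪o Fin n) : ℕ := letterSum (List.ofFn J)

lemma columnSum_le (J : Fin m ↪o Fin n) : columnSum J ≤ m * n := by
  rw [columnSum, letterSum, List.map_ofFn, List.sum_ofFn]
  refine (Finset.sum_le_card_nsmul _ _ n fun a _ => (J a).2.le).trans (by simp)

lemma ofFn_orderEmbedding_injective :
    Function.Injective fun J : Fin m ↪o Fin n => List.ofFn J := fun _ _ h =>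
  DFunLike.coe_injective (List.ofFn_injective h)

lemma pairwise_ofFn_orderEmbedding (J : Fin m ↪o Fin n) : (List.ofFn J).Pairwise (· < ·) :=
  List.pairwise_ofFn.2 fun _ _ h => J.strictMono h

/-- The exchange identity with values in a braided pair. -/
lemma QMat.sum_maxMinor_tmul (hq : q ≠ 0) {E : Type*} [Ring E] [Algebra k E] {e f : Fin n → E}
    (h : IsBraidedPair q e f) :
    ∑ I : Fin m ↪o Fin n, ∑ J : Fin m ↪o Fin n, (QMat.maxMinor q I * QMat.maxMinor q J) ⊗ₜ[k]
        (wordProd e (List.ofFn I) * wordProd f (List.ofFn J)) =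
      q ^ m • ∑ I : Fin m ↪o Fin n, ∑ J : Fin m ↪o Fin n,
        (QMat.maxMinor q J * QMat.maxMinor q I) ⊗ₜ[k]
          (wordProd f (List.ofFn J) * wordProd e (List.ofFn I)) := by
  let ιL : QMat q m n →ₐ[k] QMat q m n ⊗[k] E := Algebra.TensorProduct.includeLeft
  let ιR : E →ₐ[k] QMat q m n ⊗[k] E := Algebra.TensorProduct.includeRight
  have hX := QMat.isQuantumMatrix q m n
  have hx : IsQuantumMatrix q (fun _ _ => True) fun (i : Fin m) (j : Fin n) =>
      ιL (QMat.X q i j) := by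
    refine ⟨fun h _ _ => ?_, fun h _ _ => ?_, fun h h' _ _ => ?_, fun h h' _ _ _ _ => ?_⟩
    · simp only [← map_mul, ← map_smul, hX.row h trivial trivial]
    · simp only [← map_mul, ← map_smul, hX.col h trivial trivial]
    · simp only [← map_mul, hX.anti h h' trivial trivial]
    · simp only [← map_mul, ← map_smul, ← map_add, hX.diag h h' trivial trivial trivial trivial]
  have hcomm : ∀ a b, Commute (ιL a) (ιR b) := fun a b => by
    simp [ιL, ιR, Commute, SemiconjBy]
  have hext : ∀ {e : Fin n → E}, IsQuantumExterior q e →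
      IsQuantumExterior q fun j => ιR (e j) := fun h =>
    ⟨fun j => by rw [← map_mul, h.sq, map_zero],
      fun hjl => by simp only [← map_mul, ← map_smul, h.anti hjl]⟩
  have hT : IsBraidedPair q (fun j => ιR (e j)) fun j => ιR (f j) := by
    refine ⟨hext h.left, hext h.right, fun j => ?_, fun hjl => ?_, fun hjl => ?_⟩
    · simp only [← map_mul, ← map_smul, h.same]
    · simp only [← map_mul, ← map_smul, ← map_add, h.up hjl]
    · simp only [← map_mul, h.down hjl]
  have hword : ∀ (e : Fin n → E) (w : List (Fin n)),
      wordProd (fun j => ιR (e j)) w = ιR (wordProd e w) := fun e w => by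
    simp [wordProd, map_list_prod, Function.comp_def]
  have hrows : ∀ {e : Fin n → E}, IsQuantumExterior q e →
      (List.ofFn fun i : Fin m => ∑ j, ιL (QMat.X q i j) * ιR (e j)).prod =
        ∑ J : Fin m ↪o Fin n, QMat.maxMinor q J ⊗ₜ[k] wordProd e (List.ofFn J) := by
    intro e he
    rw [(hext he).prod_rows hq fun i j l => hcomm _ _]
    refine Finset.sum_congr rfl fun J _ => ?_
    rw [hword]
    have : (∑ σ : Equiv.Perm (Fin m),
        (-q) ^ permLength σ • (List.ofFn fun a => ιL (QMat.X q a (J (σ a)))).prod) =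
        ιL (QMat.maxMinor q J) := by
      simp [QMat.maxMinor, QMat.minor, map_sum, map_list_prod, List.map_ofFn, Function.comp_def]
    rw [this]
    simp [ιL, ιR]
  -- The rows of the coaction form a braided pair indexed by `Fin m`, so its two full words commute
  -- up to `q ^ m`; expanding each full word in minors gives the identity.
  have hpair := hx.coact hq hT (fun i j l => hcomm _ _) fun i j l => hcomm _ _
  have hmain := hpair.wordProd_mul_wordProd hq (v := List.finRange m) (w := List.finRange m)
    (List.pairwise_lt_finRange m) (List.Subset.refl _)
  simp only [wordProd, ← List.ofFn_eq_map, List.length_finRange] at hmain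
  rw [hrows h.left, hrows h.right] at hmain
  simp only [Finset.sum_mul_sum, Algebra.TensorProduct.tmul_mul_tmul] at hmain
  rw [hmain, Finset.sum_comm]

/-- Pair the exterior factor of the exchange identity with the functional dual to `e_I f_J`. The
left side reduces to the single product for `(I, J)`. On the right, triangularity leaves the
reversed product with a nonzero scalar, and otherwise only pairs in which `J'` has larger column
sum. -/
lemma QMat.exchange (hq : q ≠ 0) (I J : Fin m ↪o Fin n) :
    ∃ c : k, c ≠ 0 ∧ QMat.maxMinor q I * QMat.maxMinor q J -
        c • (QMat.maxMinor q J * QMat.maxMinor q I) ∈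
      Submodule.span k {x | ∃ J' I' : Fin m ↪o Fin n,
        columnSum I' + columnSum J' = columnSum I + columnSum J ∧ columnSum J < columnSum J' ∧
        x = QMat.maxMinor q J' * QMat.maxMinor q I'} := by
  obtain ⟨E, _, _, e, f, h, hθ⟩ := exists_braidedPair hq n
  obtain ⟨θ, hθ⟩ := hθ _ _ (pairwise_ofFn_orderEmbedding I) (pairwise_ofFn_orderEmbedding J)
  have hsum := congrArg ((TensorProduct.rid k (QMat q m n)).toLinearMap ∘ₗ
    LinearMap.lTensor (QMat q m n) θ) (QMat.sum_maxMinor_tmul (m := m) hq h)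
  simp only [map_sum, map_smul, LinearMap.comp_apply, LinearMap.lTensor_tmul,
    LinearEquiv.coe_coe, TensorProduct.rid_tmul] at hsum
  have hpair : ∀ I' J' : Fin m ↪o Fin n,
      θ (wordProd e (List.ofFn I') * wordProd f (List.ofFn J')) =
        if I' = I ∧ J' = J then 1 else 0 := fun I' J' => by
    rw [hθ _ _ (pairwise_ofFn_orderEmbedding I') (pairwise_ofFn_orderEmbedding J')]
    simp only [ofFn_orderEmbedding_injective.eq_iff]
  have hzero : ∀ {u v : List (Fin n)}, letterSum u ≠ columnSum I ∨ letterSum v ≠ columnSum J →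
      θ (wordProd e u * wordProd f v) = 0 := h.functional_eq_zero hq hθ
  have hleft : ∑ I' : Fin m ↪o Fin n, ∑ J' : Fin m ↪o Fin n,
      θ (wordProd e (List.ofFn I') * wordProd f (List.ofFn J')) •
        (QMat.maxMinor q I' * QMat.maxMinor q J') = QMat.maxMinor q I * QMat.maxMinor q J := by
    simp only [hpair, ite_and, ite_smul, one_smul, zero_smul]
    simp
  rw [hleft] at hsum
  -- Reordering `f_{J'} e_{I'}` lowers the letter sum of the `f`-part and keeps the total. A
  -- correction can be seen by `θ` only if it ends at the sums of `I` and `J`, which forces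
  -- `columnSum J < columnSum J'`.
  have hswap : ∀ I' J' : Fin m ↪o Fin n, ∃ c : k, c ≠ 0 ∧
      ((columnSum I' + columnSum J' = columnSum I + columnSum J ∧ columnSum J < columnSum J') ∨
        θ (wordProd f (List.ofFn J') * wordProd e (List.ofFn I')) =
          c * if I' = I ∧ J' = J then 1 else 0) := by
    intro I' J'
    obtain ⟨c, hc, hmem⟩ := h.wordProd_mul_wordProd_sub_mem hq (List.ofFn J') (List.ofFn I')
    refine ⟨c, hc, or_iff_not_imp_left.2 fun hn => ?_⟩
    have : θ (wordProd f (List.ofFn J') * wordProd e (List.ofFn I') -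
        c • (wordProd e (List.ofFn I') * wordProd f (List.ofFn J'))) = 0 := by
      refine Submodule.span_induction (p := fun x _ => θ x = 0) ?_ (map_zero θ) ?_ ?_ hmem
      · rintro _ ⟨u, v, h1, h2, rfl⟩
        apply hzero
        by_contra! hne
        apply hn
        rw [hne.1, hne.2] at h1
        rw [hne.2] at h2
        exact ⟨h1.symm, h2⟩
      · intro x y _ _ hx hy; rw [map_add, hx, hy, add_zero]
      · intro a x _ hx; rw [map_smul, hx, smul_zero]
    rw [map_sub, map_smul, hpair, sub_eq_zero] at this
    simpa using this
  obtain ⟨c, hc, hcIJ⟩ := hswap I J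
  have hcIJ' := hcIJ.resolve_left (by omega)
  simp only [and_self, if_true, mul_one] at hcIJ'
  refine ⟨q ^ m * c, mul_ne_zero (pow_ne_zero _ hq) hc, ?_⟩
  rw [hsum, mul_smul, ← smul_sub]
  refine Submodule.smul_mem _ _ ?_
  have hsplit : ∑ I' : Fin m ↪o Fin n, ∑ J' : Fin m ↪o Fin n,
        θ (wordProd f (List.ofFn J') * wordProd e (List.ofFn I')) •
          (QMat.maxMinor q J' * QMat.maxMinor q I') - c • (QMat.maxMinor q J * QMat.maxMinor q I) =
      ∑ I' : Fin m ↪o Fin n, ∑ J' : Fin m ↪o Fin n,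
        (θ (wordProd f (List.ofFn J') * wordProd e (List.ofFn I')) -
          if I' = I then (if J' = J then c else 0) else 0) •
          (QMat.maxMinor q J' * QMat.maxMinor q I') := by
    simp only [sub_smul, Finset.sum_sub_distrib, ite_smul, zero_smul]
    simp
  rw [hsplit]
  refine Submodule.sum_mem _ fun I' _ => Submodule.sum_mem _ fun J' _ => ?_
  obtain ⟨d, -, hd⟩ := hswap I' J'
  rcases hd with hd | hd
  · exact Submodule.smul_mem _ _ (Submodule.subset_span ⟨J', I', hd.1, hd.2, rfl⟩)
  · by_cases hI : I' = I
    · by_cases hJ : J' = J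
      · subst hI hJ
        rw [hcIJ']
        simp
      · rw [hd]; simp [hJ]
    · rw [hd]; simp [hI]

/-- With the total column sum fixed, a pair containing a sum beyond the larger of the two original
ones has a greater sum of squares. Subtracting squares from the bound `(m * n) ^ 2` gives a natural
weight for which such pairs are lower. If `I` has the larger column sum, the exchange relation is
used for `(J, I)` and solved for the other product. -/
lemma QMat.maxMinor_weightedQuasiCommutes (hq : q ≠ 0) (I J : Fin m ↪o Fin n) :
    ∃ c : k, c ≠ 0 ∧ QMat.maxMinor q I * QMat.maxMinor q J -
        c • (QMat.maxMinor q J * QMat.maxMinor q I) ∈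
      Submodule.span k {x | ∃ A B : Fin m ↪o Fin n,
        ((m * n) ^ 2 - columnSum A ^ 2) + ((m * n) ^ 2 - columnSum B ^ 2) <
          ((m * n) ^ 2 - columnSum I ^ 2) + ((m * n) ^ 2 - columnSum J ^ 2) ∧
        x = QMat.maxMinor q A * QMat.maxMinor q B} := by
  have hlt : ∀ I J I' J' : Fin m ↪o Fin n, columnSum I ≤ columnSum J →
      columnSum I' + columnSum J' = columnSum I + columnSum J → columnSum J < columnSum J' →
      ((m * n) ^ 2 - columnSum J' ^ 2) + ((m * n) ^ 2 - columnSum I' ^ 2) <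
          ((m * n) ^ 2 - columnSum I ^ 2) + ((m * n) ^ 2 - columnSum J ^ 2) := by
    intro I J I' J' h1 h2 h3
    have b1 := Nat.pow_le_pow_left (columnSum_le I) 2
    have b2 := Nat.pow_le_pow_left (columnSum_le J) 2
    have b3 := Nat.pow_le_pow_left (columnSum_le I') 2
    have b4 := Nat.pow_le_pow_left (columnSum_le J') 2
    have : columnSum I ^ 2 + columnSum J ^ 2 < columnSum I' ^ 2 + columnSum J' ^ 2 := by
      obtain ⟨t, ht⟩ := Nat.exists_eq_add_of_lt h3
      have : columnSum I = columnSum I' + t + 1 := by omega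
      rw [ht, this]
      nlinarith
    omega
  rcases le_total (columnSum I) (columnSum J) with hle | hle
  · obtain ⟨c, hc, h⟩ := QMat.exchange hq I J
    refine ⟨c, hc, Submodule.span_mono ?_ h⟩
    rintro _ ⟨J', I', h1, h2, rfl⟩
    exact ⟨J', I', hlt I J I' J' hle h1 h2, rfl⟩
  · obtain ⟨c, hc, h⟩ := QMat.exchange hq J I
    refine ⟨c⁻¹, inv_ne_zero hc, ?_⟩
    have h' := Submodule.smul_mem _ (-c⁻¹) (Submodule.span_mono (t := {x | ∃ A B : Fin m ↪o Fin n,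
        ((m * n) ^ 2 - columnSum A ^ 2) + ((m * n) ^ 2 - columnSum B ^ 2) <
          ((m * n) ^ 2 - columnSum I ^ 2) + ((m * n) ^ 2 - columnSum J ^ 2) ∧
        x = QMat.maxMinor q A * QMat.maxMinor q B}) (by
      rintro _ ⟨J', I', h1, h2, rfl⟩
      refine ⟨J', I', ?_, rfl⟩
      have := hlt J I I' J' hle h1 h2
      omega) h)
    convert h' using 1
    rw [smul_sub, smul_smul, neg_mul, inv_mul_cancel₀ hc]
    module

/-! ### The quantum grassmannian -/

lemma QMat.maxMinor_mem (J : Fin m ↪o Fin n) :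
    QMat.maxMinor q J ∈ quantumGrassmannian q m n :=
  Algebra.subset_adjoin ⟨_, J, rfl⟩

/-- The generators of the quantum grassmannian. -/
noncomputable def grassmannGenerator (q : k) (J : Fin m ↪o Fin n) : quantumGrassmannian q m n :=
  ⟨QMat.maxMinor q J, QMat.maxMinor_mem J⟩

lemma quantumGrassmannian_eq_adjoin :
    quantumGrassmannian q m n =
      Algebra.adjoin k (Set.range (QMat.maxMinor (m := m) (n := n) q)) := by
  rw [quantumGrassmannian]
  congr 1
  ext y
  constructor
  · rintro ⟨I, J, rfl⟩
    -- The rows of a maximal minor leave no choice: an increasing injection of `Fin m` into itself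
    -- is onto, hence the identity.
    have : I = RelEmbedding.refl _ := DFunLike.coe_injective
      ((StrictMono.range_inj I.strictMono strictMono_id).1 (by
        rw [(Finite.surjective_of_injective I.injective).range_eq, Set.range_id]))
    exact ⟨J, by rw [this]; rfl⟩
  · rintro ⟨J, rfl⟩
    exact ⟨_, J, rfl⟩

lemma adjoin_range_grassmannGenerator :
    Algebra.adjoin k (Set.range (grassmannGenerator (m := m) (n := n) q)) = ⊤ := by
  have hinj : Function.Injective (quantumGrassmannian q m n).val := Subtype.val_injective
  apply Subalgebra.map_injective hinj
  rw [AlgHom.map_adjoin, Algebra.map_top, Subalgebra.range_val, ← Set.range_comp]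
  exact quantumGrassmannian_eq_adjoin.symm

lemma grassmannGenerator_weightedQuasiCommutes (hq : q ≠ 0) :
    WeightedQuasiCommutes k (grassmannGenerator (m := m) (n := n) q)
      fun J => (m * n) ^ 2 - columnSum J ^ 2 := by
  intro I J
  obtain ⟨c, hc, h⟩ := QMat.maxMinor_weightedQuasiCommutes hq I J
  refine ⟨c, hc, ?_⟩
  have hinj : Function.Injective (quantumGrassmannian q m n).val.toLinearMap :=
    Subtype.val_injective
  -- The corrections are themselves products of minors, so the relation in the ambient algebra
  -- descends along the injective inclusion.
  rw [← Submodule.comap_map_eq_of_injective hinj (Submodule.span k _), Submodule.mem_comap,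
    Submodule.map_span]
  refine Submodule.span_mono ?_ h
  rintro _ ⟨A, B, hAB, rfl⟩
  exact ⟨_, ⟨A, B, hAB, rfl⟩, rfl⟩

end Exchange

/-- The quantum grassmannian is a (left and right) noetherian domain. -/
theorem mainTheorem1 {k : Type*} [Field k] (q : k) (hq : q ≠ 0) (m n : ℕ)
    (hm : 0 < m) (hmn : m ≤ n) :
    IsNoetherianRing (quantumGrassmannian q m n) ∧
      IsNoetherianRing (quantumGrassmannian q m n)ᵐᵒᵖ ∧
      IsDomain (quantumGrassmannian q m n) := by
  have h := (grassmannGenerator_weightedQuasiCommutes (m := m) (n := n) hq).isNoetherianRing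
    adjoin_range_grassmannGenerator
  have : IsDomain (QMat q m n) := QMat.isDomain m n hq (hm.trans_le hmn)
  exact ⟨h.1, h.2, inferInstance⟩
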